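/- Consider an M/M/$s$ queue ($s\ge 1$ servers, each with exponential service at rate $\mu>0$, Poisson arrivals). For $0\le\lambda<s\mu$ let $W(s,\lambda)$ be the stationary expected waiting time (including the time in service) of a customer when the arrival rate is $\lambda$, that is, $$W(s,\lambda)=\frac1\mu+\frac{C(s,\lambda)}{s\mu-\lambda},$$ where $C(s,\lambda)$ is the Erlang-C delay probability. Call a probability distribution on $\mathbb{R}$ unimodal with mode $M$ if its distribution function is convex on $(-\infty,M)$ and concave on $(M,\infty)$ (an atom at $M$ is allowed). Let $0\le \lambda_{\rm lo}\le\lambda_{\rm hi}<s\mu$, and let $\mathcal{P}$ be the set of all probability distributions with mean $m$, variance $\sigma^2$ and support contained in $[\lambda_{\rm lo},\lambda_{\rm hi}]$ that are unimodal with mode $M$. Suppose that $\mathcal{P}$ is nonempty and that $\lambda_{\rm hi}+M-2m\neq0$. Let $$W^*(s,x)=\frac1x\int_M^{x+M}W(s,t)\,dt\quad(x\ne0),\qquad W^*(s,0)=W(s,M).$$ Then $\mathbb{E}_{\mathbb P}[W(s,\Lambda)]$ is finite for every $\mathbb{P}\in\mathcal{P}$, and the tight upper bound is attained and is given by $$\max_{\mathbb{P}\in\mathcal{P}}\mathbb{E}_{\mathbb{P}}[W(s,\Lambda)]=(1-p)\,W^*(s,\lambda_1)+p\,W^*(s,\lambda_2),$$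 where $$\lambda_1=2m-2M-\frac{3\sigma^2-(m-M)^2}{\lambda_{\rm hi}+M-2m},\qquad \lambda_2=\lambda_{\rm hi}-M,\qquad p=\frac{3\sigma^2-(m-M)^2}{3\sigma^2-(m-M)^2+(\lambda_{\rm hi}+M-2m)^2}.$$ -/

import Mathlib

open MeasureTheory ProbabilityTheory

noncomputable section

/-! ### The M/M/s queue

`s` servers, each with service rate `μ`, and Poisson arrivals with rate `lam`. -/

namespace MMs

/-- Unnormalised stationary weight of having `n` customers in the system: the number of customers
is a birth-death process with birth rate `lam` and death rate `min (k + 1) s * μ` out of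
state `k + 1`. -/
def weight (s : ℕ) (μ lam : ℝ) (n : ℕ) : ℝ :=
  ∏ k ∈ Finset.range n, lam / ((min (k + 1) s : ℕ) * μ)

/-- Stationary probability of having `n` customers in the system. -/
def statProb (s : ℕ) (μ lam : ℝ) (n : ℕ) : ℝ :=
  weight s μ lam n / ∑' k, weight s μ lam k

/-- Erlang's C formula: the stationary probability that all servers are busy, i.e. that an arriving
customer experiences delay. -/
def erlangC (s : ℕ) (μ lam : ℝ) : ℝ := ∑' j, statProb s μ lam (s + j)

/-- Mean time in the system (service included) of a customer who finds `n` customers upon arrival: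
if `n ≥ s`, the customer first waits for `n + 1 - s` departures, which occur at rate `s * μ`. The
subtraction is the truncated one of `ℕ`. -/
def meanSojourn (s : ℕ) (μ : ℝ) (n : ℕ) : ℝ := ((n + 1 - s : ℕ) : ℝ) / (s * μ) + 1 / μ

/-- `W(s, lam)`: the expected (stationary) waiting time of a customer, service included. A customer
arriving according to a Poisson process sees the stationary distribution. -/
def W (s : ℕ) (μ lam : ℝ) : ℝ := ∑' n, statProb s μ lam n * meanSojourn s μ n

lemma weight_of_le {s : ℕ} (μ lam : ℝ) {n : ℕ} (h : n ≤ s) :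
    weight s μ lam n = (lam / μ) ^ n / n.factorial := by
  induction n with
  | zero => simp [weight]
  | succ n ih =>
    have := ih (by omega)
    unfold weight at this ⊢
    rw [Finset.prod_range_succ, this, min_eq_left h, Nat.factorial_succ, pow_succ]
    rw [div_mul_div_comm, ← mul_div_assoc, div_div]
    push_cast
    ring

lemma weight_add (s : ℕ) (μ lam : ℝ) (j : ℕ) :
    weight s μ lam (s + j) = (lam / μ) ^ s / s.factorial * (lam / (s * μ)) ^ j := by
  induction j with
  | zero => simp [weight_of_le]
  | succ j ih =>
    unfold weight at ih ⊢
    rw [← add_assoc, Finset.prod_range_succ, ih, min_eq_right (by omega), pow_succ]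
    ring

lemma hasSum_weight {s : ℕ} {μ lam : ℝ} (hlam : 0 ≤ lam) (hstab : lam < s * μ) :
    HasSum (weight s μ lam) (∑ k ∈ Finset.range s, (lam / μ) ^ k / k.factorial +
      (lam / μ) ^ s / s.factorial * (1 - lam / (s * μ))⁻¹) := by
  have hr1 : lam / (s * μ) < 1 := (div_lt_one (lt_of_le_of_lt hlam hstab)).2 hstab
  have hr0 : 0 ≤ lam / (s * μ) := div_nonneg hlam (hlam.trans hstab.le)
  rw [← hasSum_nat_add_iff' s]
  have h1 : ∑ k ∈ Finset.range s, weight s μ lam k =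
      ∑ k ∈ Finset.range s, (lam / μ) ^ k / k.factorial :=
    Finset.sum_congr rfl fun k hk => weight_of_le μ lam (Finset.mem_range.1 hk).le
  rw [h1, add_sub_cancel_left]
  have h2 := (hasSum_geometric_of_lt_one hr0 hr1).mul_left ((lam / μ) ^ s / s.factorial)
  refine h2.congr_fun fun j => ?_
  rw [add_comm j s, weight_add]

lemma tsum_weight_pos {s : ℕ} {μ lam : ℝ} (hlam : 0 ≤ lam) (hstab : lam < s * μ) :
    0 < ∑' k, weight s μ lam k := by
  have hμ : 0 ≤ μ := by
    by_contra! h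
    have : (s : ℝ) * μ ≤ 0 := mul_nonpos_of_nonneg_of_nonpos (Nat.cast_nonneg s) h.le
    linarith
  have h0 : ∀ k, 0 ≤ weight s μ lam k := fun k =>
    Finset.prod_nonneg fun i _ => div_nonneg hlam (mul_nonneg (Nat.cast_nonneg _) hμ)
  refine (hasSum_weight hlam hstab).summable.tsum_pos h0 0 ?_
  simp [weight]

/-- The stationary probabilities sum to one. -/
lemma hasSum_statProb {s : ℕ} {μ lam : ℝ} (hlam : 0 ≤ lam) (hstab : lam < s * μ) :
    HasSum (statProb s μ lam) 1 := by
  have h := (hasSum_weight hlam hstab).summable.hasSum.div_const (∑' k, weight s μ lam k)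
  rwa [div_self (tsum_weight_pos hlam hstab).ne'] at h

/-- The stationary probabilities satisfy the balance equations of the birth-death process. -/
lemma balance {s : ℕ} (hs : 0 < s) {μ : ℝ} (hμ : 0 < μ) (lam : ℝ) (n : ℕ) :
    lam * statProb s μ lam n = (min (n + 1) s : ℕ) * μ * statProb s μ lam (n + 1) := by
  have h : ((min (n + 1) s : ℕ) : ℝ) ≠ 0 := by
    have : 0 < min (n + 1) s := by simp [hs]
    positivity
  have hw : weight s μ lam (n + 1) = weight s μ lam n * (lam / ((min (n + 1) s : ℕ) * μ)) :=
    Finset.prod_range_succ _ _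
  unfold statProb
  rw [hw]
  field_simp

/-- The usual closed form of Erlang's C formula. -/
lemma erlangC_eq {s : ℕ} {μ lam : ℝ} (hlam : 0 ≤ lam) (hstab : lam < s * μ) :
    erlangC s μ lam = ((lam / μ) ^ s / s.factorial) /
      ((1 - lam / (s * μ)) * ∑ k ∈ Finset.range s, (lam / μ) ^ k / k.factorial +
        (lam / μ) ^ s / s.factorial) := by
  have hr1 : lam / (s * μ) < 1 := (div_lt_one (lt_of_le_of_lt hlam hstab)).2 hstab
  have hr0 : 0 ≤ lam / (s * μ) := div_nonneg hlam (hlam.trans hstab.le)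
  have hZ := tsum_weight_pos hlam hstab
  unfold erlangC statProb
  simp_rw [weight_add]
  rw [tsum_div_const, tsum_mul_left, tsum_geometric_of_lt_one hr0 hr1]
  rw [(hasSum_weight hlam hstab).tsum_eq] at hZ ⊢
  have h1 : (1 - lam / (s * μ)) ≠ 0 := by linarith
  rw [← mul_div_mul_left _ _ h1]
  congr 1
  · field_simp
  · field_simp

/-- The classic formula for the expected waiting time in terms of Erlang's C formula. -/
lemma W_eq {s : ℕ} {μ lam : ℝ} (hlam : 0 ≤ lam) (hstab : lam < s * μ) :
    W s μ lam = 1 / μ + erlangC s μ lam / (s * μ - lam) := by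
  have hsμ : 0 < s * μ := lt_of_le_of_lt hlam hstab
  have hr1 : lam / (s * μ) < 1 := (div_lt_one hsμ).2 hstab
  have hr0 : 0 ≤ lam / (s * μ) := div_nonneg hlam hsμ.le
  have hn : ‖lam / (s * μ)‖ < 1 := by rwa [Real.norm_of_nonneg hr0]
  set r := lam / (s * μ) with hr
  set c := (lam / μ) ^ s / s.factorial / ∑' k, weight s μ lam k with hc
  have hp : ∀ j, statProb s μ lam (s + j) = c * r ^ j := fun j => by
    unfold statProb
    rw [weight_add]
    ring
  have hC : erlangC s μ lam = c * (1 - r)⁻¹ := by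
    unfold erlangC
    simp_rw [hp]
    rw [tsum_mul_left, tsum_geometric_of_lt_one hr0 hr1]
  have hA : HasSum (fun n => statProb s μ lam n * (((n + 1 - s : ℕ) : ℝ) / (s * μ)))
      (c / (s * μ) * (r / (1 - r) ^ 2 + (1 - r)⁻¹)) := by
    rw [← hasSum_nat_add_iff' s]
    have h0 : ∑ n ∈ Finset.range s, statProb s μ lam n * (((n + 1 - s : ℕ) : ℝ) / (s * μ)) = 0 := by
      refine Finset.sum_eq_zero fun n hn => ?_
      have : n + 1 - s = 0 := by have := Finset.mem_range.1 hn; omega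
      simp [this]
    rw [h0, sub_zero]
    have h2 := ((hasSum_coe_mul_geometric_of_norm_lt_one hn).add
      (hasSum_geometric_of_lt_one hr0 hr1)).mul_left (c / (s * μ))
    refine h2.congr_fun fun j => ?_
    rw [show j + s + 1 - s = j + 1 by omega, add_comm j s, hp]
    push_cast
    ring
  have hB := (hasSum_statProb hlam hstab).mul_right (1 / μ)
  have hW : W s μ lam = c / (s * μ) * (r / (1 - r) ^ 2 + (1 - r)⁻¹) + 1 * (1 / μ) := by
    rw [← (hA.add hB).tsum_eq]
    exact tsum_congr fun n => mul_add _ _ _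
  have h1 : 1 - r ≠ 0 := by linarith
  have h2 : s * μ - lam = s * μ * (1 - r) := by
    rw [hr, mul_sub, mul_one, mul_div_cancel₀ _ hsμ.ne']
  rw [hW, hC, h2]
  field_simp
  ring

end MMs

/-! ### Unimodal distributions with given mean, variance and support -/

/-- A distribution on the real line is unimodal with mode `M` if its distribution function is convex
to the left of `M` and concave to the right of `M`; an atom at `M` is allowed. -/
def IsUnimodal (P : Measure ℝ) (M : ℝ) : Prop :=
  ConvexOn ℝ (Set.Iio M) (cdf P) ∧ ConcaveOn ℝ (Set.Ioi M) (cdf P)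

/-- The set of all probability distributions with mean `m`, variance `σ ^ 2`, support contained in
`[lo, hi]`, and unimodal with mode `M`. -/
def unimodalAmbiguitySet (m σ M lo hi : ℝ) : Set (Measure ℝ) :=
  {P | IsProbabilityMeasure P ∧ (∀ᵐ x ∂P, x ∈ Set.Icc lo hi) ∧
    ∫ x, x ∂P = m ∧ ∫ x, x ^ 2 ∂P = σ ^ 2 + m ^ 2 ∧ IsUnimodal P M}

/-- `W^*(s, x) = (1 / x) ∫_M^{x + M} W(s, t) dt`, with the limiting value `W(s, M)` at `x = 0`. -/
def Wstar (s : ℕ) (μ M x : ℝ) : ℝ :=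
  if x = 0 then MMs.W s μ M else (1 / x) * ∫ t in M..(x + M), MMs.W s μ t

end

/-! A law that is unimodal at `M` is a mixture of uniform laws on the segments from `M` to `M + Z`
(Khinchin). The constraints say that `Z` lies in `[lo - M, hi - M]` and has mean `2 (m - M)` and
variance `V = 3 σ² - (m - M)²`, while the expected waiting time is the mean of `W*(Z)`. What remains
is a two-moment problem on an interval.

Its solution rests on `W` having a nonnegative third derivative. Averaged over segments, this makes
the quadratic that touches `W*` at `l₁` and meets it at the right end `l₂` a majorant of `W*`
(`segmentMean_le_hermite`). The mean of a quadratic in `Z` depends only on the two moments, which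
gives the upper bound (`integral_le_of_segmentMean_le`). The law of `Z` on `{l₁, l₂}` with weights
`1 - p` and `p` has the right moments and charges only points where quadratic and `W*` agree, so the
bound is attained.

Of Khinchin's theorem only the dual half is needed (`IsUnimodal.integral_nonneg`): away from `M` the
law has a density monotone on each side, whose superlevel sets are intervals ending at `M`, and the
layer-cake formula integrates over these.

For the third derivative, the scaled delay `D` at offered load `a` solves the Riccati equation `D' =
D (R - D)` with `R = s/a - 1 + 2/(s - a)`. Hence `D'''/D` is a polynomial in `D`, `R`, `R'`, `R''`.
Scaled by `(s - a)³` it becomes a cubic in Erlang's `C = (s - a) D`, nonnegative because `C ≤ 1/(1 +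
(s - a)²/a)` (`cubic_nonneg`, `delay_bound`). -/

/-! ### Functions with monotone second derivative -/

/-- Taylor's formula of second order with integral remainder. -/
lemma taylor_integral_remainder_two {f f' f'' : ℝ → ℝ} {I : Set ℝ} (hI : I.OrdConnected)
    (hf : ∀ x ∈ I, HasDerivAt f (f' x) x) (hf' : ∀ x ∈ I, HasDerivAt f' (f'' x) x)
    (hc : ContinuousOn f'' I) {x c : ℝ} (hx : x ∈ I) (hcI : c ∈ I) :
    f x - f c - f' c * (x - c) =
      (x - c) ^ 2 * ∫ t in (0 : ℝ)..1, (1 - t) * f'' (c + t * (x - c)) := by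
  have hmem : ∀ t ∈ Set.uIcc (0 : ℝ) 1, c + t * (x - c) ∈ I := by
    intro t ht
    rw [Set.uIcc_of_le zero_le_one] at ht
    have h := hI.convex hcI hx (sub_nonneg.2 ht.2) ht.1 (by ring)
    simp only [smul_eq_mul] at h
    convert h using 1
    ring
  have hlin : ∀ t : ℝ, HasDerivAt (fun t => c + t * (x - c)) (x - c) t := fun t => by
    simpa using ((hasDerivAt_id t).mul_const (x - c)).const_add c
  have hcont : ContinuousOn (fun t => (1 - t) * f'' (c + t * (x - c))) (Set.uIcc 0 1) := by
    refine ContinuousOn.mul (by fun_prop) (hc.comp (by fun_prop) hmem)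
  -- The primitive equals `f x` at `t = 1` and the first-order Taylor polynomial at `t = 0`.
  have h := intervalIntegral.integral_eq_sub_of_hasDerivAt
    (f := fun t => (1 - t) * (x - c) * f' (c + t * (x - c)) + f (c + t * (x - c)))
    (f' := fun t => (x - c) ^ 2 * ((1 - t) * f'' (c + t * (x - c)))) (a := 0) (b := 1)
    (fun t ht => by
      have h1 := (hf' _ (hmem t ht)).comp t (hlin t)
      have h2 := (hf _ (hmem t ht)).comp t (hlin t)
      have h3 : HasDerivAt (fun t : ℝ => (1 - t) * (x - c)) (-(x - c)) t := by
        simpa using ((hasDerivAt_id t).const_sub 1).mul_const (x - c)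
      refine ((h3.mul h1).add h2).congr_deriv ?_
      simp only [Function.comp]
      ring)
    ((hcont.const_smul ((x - c) ^ 2)).intervalIntegrable)
  rw [intervalIntegral.integral_const_mul] at h
  rw [h]
  simp only [sub_self, zero_mul, one_mul, sub_zero, add_zero, zero_add, add_sub_cancel]
  ring

/-- A function with monotone second derivative lies below the quadratic polynomial that touches it
at `c` to first order and meets it at a point `b` to the right. -/
lemma le_hermite_of_monotoneOn {f f' f'' : ℝ → ℝ} {I : Set ℝ} (hI : I.OrdConnected)
    (hf : ∀ x ∈ I, HasDerivAt f (f' x) x) (hf' : ∀ x ∈ I, HasDerivAt f' (f'' x) x)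
    (hc : ContinuousOn f'' I) (hm : MonotoneOn f'' I) {x c b : ℝ} (hx : x ∈ I) (hcI : c ∈ I)
    (hb : b ∈ I) (hxb : x ≤ b) :
    (f x - f c - f' c * (x - c)) * (b - c) ^ 2 ≤ (f b - f c - f' c * (b - c)) * (x - c) ^ 2 := by
  rw [taylor_integral_remainder_two hI hf hf' hc hx hcI,
    taylor_integral_remainder_two hI hf hf' hc hb hcI]
  have hmem : ∀ y ∈ I, ∀ t ∈ Set.Icc (0 : ℝ) 1, c + t * (y - c) ∈ I := by
    intro y hy t ht
    have h := hI.convex hcI hy (sub_nonneg.2 ht.2) ht.1 (by ring)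
    simp only [smul_eq_mul] at h
    convert h using 1
    ring
  have hint : ∀ y ∈ I, IntervalIntegrable (fun t => (1 - t) * f'' (c + t * (y - c))) volume 0 1 := by
    intro y hy
    refine ContinuousOn.intervalIntegrable ?_
    rw [Set.uIcc_of_le zero_le_one]
    exact ContinuousOn.mul (by fun_prop) (hc.comp (by fun_prop) (hmem y hy))
  -- Since `x ≤ b`, the point at parameter `t` on the way from `c` to `x` is to the left of the one
  -- on the way to `b`, whatever the position of `c`.
  have hle := intervalIntegral.integral_mono_on (zero_le_one' ℝ) (hint x hx) (hint b hb)
    (fun t ht => mul_le_mul_of_nonneg_left (hm (hmem x hx t ht) (hmem b hb t ht)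
      (by nlinarith [ht.1, mul_le_mul_of_nonneg_left hxb ht.1])) (sub_nonneg.2 ht.2))
  calc _ = (x - c) ^ 2 * (b - c) ^ 2 * ∫ t in (0 : ℝ)..1, (1 - t) * f'' (c + t * (x - c)) := by ring
    _ ≤ (x - c) ^ 2 * (b - c) ^ 2 * ∫ t in (0 : ℝ)..1, (1 - t) * f'' (c + t * (b - c)) := by
      gcongr
    _ = _ := by ring

/-! ### The mean waiting time has a nonnegative third derivative -/

namespace MMs

/-- Partial sums of the exponential series dominate a multiple of their last term. -/
lemma sub_mul_le_sum_exp (n : ℕ) {a : ℝ} (ha : 0 ≤ a) :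
    (n + 1 - a) * (a ^ n / n.factorial) ≤ ∑ k ∈ Finset.range (n + 1), a ^ k / k.factorial := by
  induction n with
  | zero => simp [ha]
  | succ n ih =>
    rw [Finset.sum_range_succ]
    have hfac : ((n + 1).factorial : ℝ) = (n + 1) * n.factorial := by
      push_cast [Nat.factorial_succ]; ring
    have hE : a ^ (n + 1) / ((n + 1).factorial : ℝ) = a ^ n / n.factorial * (a / (n + 1)) := by
      rw [hfac, pow_succ, mul_comm ((n : ℝ) + 1), mul_div_mul_comm]
    have h0 : 0 ≤ a ^ n / (n.factorial : ℝ) := by positivity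
    have key : (n + 1 + 1 - a) * (a / (n + 1)) ≤ (n + 1 - a) + a / (n + 1) := by
      have hn : (0 : ℝ) < n + 1 := by positivity
      rw [← sub_nonneg]
      have : (n + 1 - a) + a / (n + 1) - (n + 1 + 1 - a) * (a / (n + 1))
          = (n + 1 - a) ^ 2 / (n + 1) := by field_simp; ring
      rw [this]; positivity
    rw [hE]
    push_cast
    nlinarith [mul_le_mul_of_nonneg_left key h0]

/-- The polynomial whose nonnegativity governs the third derivative of the mean waiting time. -/
lemma quadratic_nonneg {s : ℕ} (hs : 1 ≤ s) {x r : ℝ} (hr : 0 < r)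
    (hx : x * (1 + r) = s * r ^ 2) :
    0 ≤ x ^ 3 + 4 * x ^ 2 + 8 * x + 12 - r * (3 * x ^ 2 + 7 * x) + 2 * r ^ 2 * (1 + x) := by
  have h1r : 0 < 1 + r := by linarith
  have hxe : x = s * r ^ 2 / (1 + r) := by field_simp; linarith
  -- For `s = 1, 2`, eliminating `x` leaves a numerator with positive coefficients. For `s ≥ 3`,
  -- either `2 r ≤ x`, and expanding in `x - 2 r` shows positivity, or `r < 2` and `x < 4`, where
  -- the discriminant in `r` is negative.
  obtain rfl | rfl | h3 : s = 1 ∨ s = 2 ∨ 3 ≤ s := by omega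
  · have : x ^ 3 + 4 * x ^ 2 + 8 * x + 12 - r * (3 * x ^ 2 + 7 * x) + 2 * r ^ 2 * (1 + x)
        = (6 * r ^ 4 + 27 * r ^ 3 + 46 * r ^ 2 + 36 * r + 12) / (1 + r) ^ 3 := by
      rw [hxe]; field_simp; push_cast; ring
    rw [this]; positivity
  · have : x ^ 3 + 4 * x ^ 2 + 8 * x + 12 - r * (3 * x ^ 2 + 7 * x) + 2 * r ^ 2 * (1 + x)
        = (14 * r ^ 4 + 36 * r ^ 3 + 54 * r ^ 2 + 36 * r + 12) / (1 + r) ^ 3 := by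
      rw [hxe]; field_simp; push_cast; ring
    rw [this]; positivity
  · have hs3 : (3 : ℝ) ≤ s := by exact_mod_cast h3
    have hx3 : 3 * r ^ 2 ≤ x * (1 + r) := by rw [hx]; gcongr
    have hx0 : 0 ≤ x := by rw [hxe]; positivity
    by_cases h : 2 * r ≤ x
    · obtain ⟨y, rfl⟩ : ∃ y, x = 2 * r + y := ⟨x - 2 * r, by ring⟩
      have hy : 0 ≤ y := by linarith
      have : (2 * r + y) ^ 3 + 4 * (2 * r + y) ^ 2 + 8 * (2 * r + y) + 12
          - r * (3 * (2 * r + y) ^ 2 + 7 * (2 * r + y)) + 2 * r ^ 2 * (1 + (2 * r + y))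
          = (2 * r + y) * (r + y) * y + 4 * r ^ 2 + 9 * r * y + 4 * y ^ 2 + 8 * (2 * r + y) + 12 := by
        ring
      rw [this]; positivity
    · have hr2 : r < 2 := by nlinarith
      have hx4 : x < 4 := by linarith
      have hsq : 0 ≤ 8 * (1 + x) * (x ^ 3 + 4 * x ^ 2 + 8 * x + 12 - r * (3 * x ^ 2 + 7 * x)
          + 2 * r ^ 2 * (1 + x)) := by
        have hd : 0 ≤ 96 + 160 * x + 47 * x ^ 2 - 2 * x ^ 3 - x ^ 4 := by
          have : x ^ 2 ≤ 16 := by nlinarith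
          nlinarith [mul_nonneg hx0 hx0, mul_nonneg (mul_nonneg hx0 hx0) (sub_nonneg.2 hx4.le),
            mul_nonneg (mul_nonneg hx0 hx0) (sub_nonneg.2 this)]
        have : 8 * (1 + x) * (x ^ 3 + 4 * x ^ 2 + 8 * x + 12 - r * (3 * x ^ 2 + 7 * x)
          + 2 * r ^ 2 * (1 + x)) = (4 * (1 + x) * r - (3 * x ^ 2 + 7 * x)) ^ 2 +
          (96 + 160 * x + 47 * x ^ 2 - 2 * x ^ 3 - x ^ 4) := by ring
        rw [this]; positivity
      exact nonneg_of_mul_nonneg_right hsq (by positivity)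

/-- The cubic in Erlang's delay probability `C` to which the sign of the third derivative of the
mean waiting time reduces. -/
lemma cubic_nonneg {s : ℕ} (hs : 1 ≤ s) {x r C : ℝ} (hr : 0 < r)
    (hx : x * (1 + r) = s * r ^ 2) (hC : C * (1 + x) ≤ 1) :
    0 ≤ (x ^ 3 + 3 * x ^ 2 + 12 * x + 24 - 3 * r * x ^ 2 - 4 * r * x + 2 * r ^ 2 * x)
      - (7 * x ^ 2 + 24 * x + 36 - 4 * r * x) * C + 12 * (x + 2) * C ^ 2 - 6 * C ^ 3 := by
  have h1r : 0 < 1 + r := by linarith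
  have hxe : x = s * r ^ 2 / (1 + r) := by field_simp; linarith
  have hx0 : 0 ≤ x := by rw [hxe]; positivity
  have hs1 : (1 : ℝ) ≤ s := by exact_mod_cast hs
  have hx1 : r - 1 ≤ x := by
    have : r ^ 2 ≤ x * (1 + r) := by rw [hx]; nlinarith [sq_nonneg r]
    nlinarith
  have h1x : 0 < 1 + x := by linarith
  set C₀ := 1 / (1 + x) with hC₀
  have hC₀x : C₀ * (1 + x) = 1 := by rw [hC₀]; field_simp
  have hC₀0 : 0 < C₀ := by positivity
  have hCC : C ≤ C₀ := by rw [hC₀, le_div_iff₀ h1x]; exact hC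
  have hC₀1 : C₀ ≤ 1 := by nlinarith
  have hK := quadratic_nonneg hs hr hx
  have hT0 : 0 ≤ (x ^ 3 + 3 * x ^ 2 + 12 * x + 24 - 3 * r * x ^ 2 - 4 * r * x + 2 * r ^ 2 * x)
      - (7 * x ^ 2 + 24 * x + 36 - 4 * r * x) * C₀ + 12 * (x + 2) * C₀ ^ 2 - 6 * C₀ ^ 3 := by
    -- At the extreme value `C₀ = 1/(1 + x)` the cubic reduces to the polynomial of
    -- `quadratic_nonneg`.
    have : (x ^ 3 + 3 * x ^ 2 + 12 * x + 24 - 3 * r * x ^ 2 - 4 * r * x + 2 * r ^ 2 * x)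
      - (7 * x ^ 2 + 24 * x + 36 - 4 * r * x) * C₀ + 12 * (x + 2) * C₀ ^ 2 - 6 * C₀ ^ 3
      = C₀ ^ 3 * ((1 + x) ^ 2 * x * (x ^ 3 + 4 * x ^ 2 + 8 * x + 12 - r * (3 * x ^ 2 + 7 * x)
        + 2 * r ^ 2 * (1 + x)) + 12 * x + 6) := by
      rw [hC₀]; field_simp; ring
    rw [this]; positivity
  -- This product is the value of the cubic at `C` minus that at `C₀`. Its second factor is smallest
  -- at `C = C₀`, where `r ≤ x + 1` and a square settle the sign.
  have hdiff : 0 ≤ (C₀ - C) * ((7 * x ^ 2 + 24 * x + 36 - 4 * r * x) - 12 * (x + 2) * (C + C₀)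
      + 6 * (C ^ 2 + C * C₀ + C₀ ^ 2)) := by
    refine mul_nonneg (by linarith) ?_
    have h1 : 0 ≤ (C₀ - C) * (12 * (x + 2) - 6 * (C + 2 * C₀)) :=
      mul_nonneg (by linarith) (by linarith)
    have h2 : 0 ≤ 7 * x ^ 2 + 24 * x + 4 - 4 * r * x := by nlinarith
    have h3 : 24 * (x + 2) * C₀ = 24 + 24 * C₀ := by linear_combination 24 * hC₀x
    nlinarith [sq_nonneg (3 * C₀ - 2)]
  linarith

end MMs

/-! ### The delay as a function of the offered load: Riccati equation and third derivative -/

noncomputable section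
namespace MMs

/-- Partial sum of the exponential series with `s` terms. -/
def expSum (s : ℕ) (a : ℝ) : ℝ := ∑ k ∈ Finset.range s, a ^ k / k.factorial

/-- Denominator of the scaled mean delay at offered load `a`. -/
def delayDenom (s : ℕ) (a : ℝ) : ℝ :=
  (s - a) ^ 2 * expSum s a / s + (s - a) * (a ^ s / s.factorial)

/-- Mean delay, in units of the mean service time, at offered load `a`. -/
def delay (s : ℕ) (a : ℝ) : ℝ := a ^ s / s.factorial / delayDenom s a

lemma expSum_pos {s : ℕ} (hs : 1 ≤ s) {a : ℝ} (ha : 0 ≤ a) : 0 < expSum s a := by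
  obtain ⟨n, rfl⟩ : ∃ n, s = n + 1 := ⟨s - 1, by omega⟩
  unfold expSum
  rw [Finset.sum_range_succ']
  have : 0 ≤ ∑ k ∈ Finset.range n, a ^ (k + 1) / ((k + 1).factorial : ℝ) :=
    Finset.sum_nonneg fun k _ => by positivity
  simp only [pow_zero, Nat.factorial_zero, Nat.cast_one, div_one]
  linarith

lemma delayDenom_pos {s : ℕ} (hs : 1 ≤ s) {a : ℝ} (ha : 0 ≤ a) (has : a < s) :
    0 < delayDenom s a := by
  have h1 := expSum_pos hs ha
  have h2 : 0 < (s : ℝ) - a := by linarith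
  have h3 : (0 : ℝ) < s := by linarith
  unfold delayDenom
  positivity

lemma W_eq_delay {s : ℕ} {μ lam : ℝ} (hs : 1 ≤ s) (hμ : 0 < μ) (hlam : 0 ≤ lam)
    (hstab : lam < s * μ) : W s μ lam = 1 / μ * (1 + delay s (lam / μ)) := by
  have ha : 0 ≤ lam / μ := by positivity
  have has : lam / μ < s := by rwa [div_lt_iff₀ hμ]
  have hq := delayDenom_pos hs ha has
  have hs0 : (0 : ℝ) < s := by exact_mod_cast hs
  rw [W_eq hlam hstab, erlangC_eq hlam hstab, delay]
  have e1 : 1 - lam / (s * μ) = (s - lam / μ) / s := by field_simp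
  have e2 : s * μ - lam = μ * (s - lam / μ) := by field_simp
  have e3 : delayDenom s (lam / μ) = (s - lam / μ) * ((s - lam / μ) / s *
      ∑ k ∈ Finset.range s, (lam / μ) ^ k / k.factorial + (lam / μ) ^ s / s.factorial) := by
    unfold delayDenom expSum; ring
  rw [e1, e2, e3]
  have h2 : (s - lam / μ) ≠ 0 := by linarith
  rw [div_div]
  field_simp

lemma hasDerivAt_pow_div_factorial (n : ℕ) (a : ℝ) :
    HasDerivAt (fun a : ℝ => a ^ (n + 1) / ((n + 1).factorial : ℝ)) (a ^ n / n.factorial) a := by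
  refine ((hasDerivAt_pow (n + 1) a).div_const _).congr_deriv ?_
  rw [Nat.factorial_succ]
  push_cast
  rw [mul_div_mul_left _ _ (by positivity : (n + 1 : ℝ) ≠ 0)]

lemma hasDerivAt_expSum (n : ℕ) (a : ℝ) : HasDerivAt (expSum (n + 1)) (expSum n a) a := by
  have h : expSum (n + 1) =
      fun a => ∑ k ∈ Finset.range n, a ^ (k + 1) / ((k + 1).factorial : ℝ) + 1 := by
    funext a
    simp [expSum, Finset.sum_range_succ']
  rw [h]
  exact (HasDerivAt.fun_sum fun k _ => hasDerivAt_pow_div_factorial k a).add_const 1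

/-- Differentiating the truncated exponential only drops its last term, so the denominator satisfies
a first-order linear equation; this is what closes the Riccati equation. -/
lemma hasDerivAt_delayDenom {s : ℕ} (hs : 1 ≤ s) {a : ℝ} (has : a ≠ s) :
    HasDerivAt (delayDenom s)
      (delayDenom s a * (1 - 2 / (s - a)) + a ^ s / s.factorial) a := by
  obtain ⟨n, rfl⟩ : ∃ n, s = n + 1 := ⟨s - 1, by omega⟩
  have hsub : ((n + 1 : ℕ) : ℝ) - a ≠ 0 := sub_ne_zero.2 (Ne.symm has)
  have h1 : HasDerivAt (fun a : ℝ => ((n + 1 : ℕ) : ℝ) - a) (-1) a := by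
    simpa using (hasDerivAt_id a).const_sub ((n + 1 : ℕ) : ℝ)
  have h := (((h1.pow 2).mul (hasDerivAt_expSum n a)).div_const ((n + 1 : ℕ) : ℝ)).add
    (h1.mul (hasDerivAt_pow_div_factorial n a))
  refine h.congr_deriv ?_
  have hE : expSum (n + 1) a = expSum n a + a ^ n / n.factorial := Finset.sum_range_succ _ _
  have hN : a ^ (n + 1) / ((n + 1).factorial : ℝ) = a * (a ^ n / n.factorial) / (n + 1 : ℕ) := by
    rw [Nat.factorial_succ]; push_cast; field_simp; ring
  have hn : ((n + 1 : ℕ) : ℝ) ≠ 0 := by positivity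
  simp only [delayDenom, hE, Pi.pow_apply]
  rw [hN]
  generalize a ^ n / (n.factorial : ℝ) = e
  generalize expSum n a = S
  generalize ((n + 1 : ℕ) : ℝ) = c at *
  field_simp
  ring

/-- Logarithmic growth rate in the Riccati equation for the delay. -/
def rate (s : ℕ) (a : ℝ) : ℝ := s / a - 1 + 2 / (s - a)

/-- The numerator has logarithmic derivative `s / a`; in that of the denominator, the inhomogeneous
term divided by `delayDenom` is the delay itself. -/
lemma hasDerivAt_delay {s : ℕ} (hs : 1 ≤ s) {a : ℝ} (ha : 0 < a) (has : a < s) :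
    HasDerivAt (delay s) (delay s a * (rate s a - delay s a)) a := by
  have hq := delayDenom_pos hs ha.le has
  have hd := hasDerivAt_delayDenom hs has.ne
  obtain ⟨n, rfl⟩ : ∃ n, s = n + 1 := ⟨s - 1, by omega⟩
  have h := (hasDerivAt_pow_div_factorial n a).div hd hq.ne'
  refine h.congr_deriv ?_
  have hN : a ^ n / n.factorial = a ^ (n + 1) / ((n + 1).factorial : ℝ) * ((n + 1 : ℕ) / a) := by
    rw [Nat.factorial_succ]; push_cast; field_simp; ring
  have hsub : ((n + 1 : ℕ) : ℝ) - a ≠ 0 := by linarith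
  rw [delay, rate, hN]
  generalize a ^ (n + 1) / ((n + 1).factorial : ℝ) = e
  generalize delayDenom (n + 1) a = q at *
  generalize ((n + 1 : ℕ) : ℝ) = c at *
  field_simp
  ring

lemma hasDerivAt_rate {s : ℕ} {a : ℝ} (ha : 0 < a) (has : a < s) :
    HasDerivAt (rate s) (-s / a ^ 2 + 2 / (s - a) ^ 2) a := by
  have hsub : (s : ℝ) - a ≠ 0 := by linarith
  have h1 : HasDerivAt (fun a : ℝ => (s : ℝ) - a) (-1) a := by
    simpa using (hasDerivAt_id a).const_sub (s : ℝ)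
  have h := (((hasDerivAt_const a (s : ℝ)).div (hasDerivAt_id a) ha.ne').sub_const 1).add
    ((hasDerivAt_const a (2 : ℝ)).div h1 hsub)
  refine h.congr_deriv ?_
  simp

lemma hasDerivAt_deriv_rate {s : ℕ} {a : ℝ} (ha : 0 < a) (has : a < s) :
    HasDerivAt (fun a : ℝ => -(s : ℝ) / a ^ 2 + 2 / (s - a) ^ 2)
      (2 * s / a ^ 3 + 4 / (s - a) ^ 3) a := by
  have hsub : (s : ℝ) - a ≠ 0 := by linarith
  have h1 : HasDerivAt (fun a : ℝ => (s : ℝ) - a) (-1) a := by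
    simpa using (hasDerivAt_id a).const_sub (s : ℝ)
  have h := ((hasDerivAt_const a (-(s : ℝ))).div ((hasDerivAt_id a).pow 2)
    (pow_ne_zero 2 ha.ne')).add
    ((hasDerivAt_const a (2 : ℝ)).div (h1.pow 2) (pow_ne_zero 2 hsub))
  refine h.congr_deriv ?_
  simp only [Pi.pow_apply, id]
  field_simp
  ring

/-- The hypothesis `C * (1 + x) ≤ 1` of `cubic_nonneg`, obtained by inserting `sub_mul_le_sum_exp`
into the denominator. -/
lemma delay_bound {s : ℕ} (hs : 1 ≤ s) {a : ℝ} (ha : 0 < a) (has : a < s) :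
    (s - a) * delay s a * (1 + (s - a) ^ 2 / a) ≤ 1 := by
  have hq := delayDenom_pos hs ha.le has
  have hsub : 0 < (s : ℝ) - a := by linarith
  have hs0 : (0 : ℝ) < s := by linarith
  have hS : (s - a) * (a ^ s / s.factorial * (s / a)) ≤ expSum s a := by
    obtain ⟨n, rfl⟩ : ∃ n, s = n + 1 := ⟨s - 1, by omega⟩
    have h := sub_mul_le_sum_exp n ha.le
    have hN : a ^ n / n.factorial =
        a ^ (n + 1) / ((n + 1).factorial : ℝ) * ((n + 1 : ℕ) / a) := by
      rw [Nat.factorial_succ]; push_cast; field_simp; ring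
    rw [hN] at h
    simpa [expSum] using h
  rw [delay]
  rw [show (s - a) * (a ^ s / s.factorial / delayDenom s a) * (1 + (s - a) ^ 2 / a)
    = ((s - a) * (a ^ s / s.factorial) * (1 + (s - a) ^ 2 / a)) / delayDenom s a by ring]
  rw [div_le_one hq]
  calc _ = (s - a) ^ 2 * ((s - a) * (a ^ s / s.factorial * (s / a))) / s
        + (s - a) * (a ^ s / s.factorial) := by field_simp; ring
    _ ≤ _ := by unfold delayDenom; gcongr

/-- The quotient of the third derivative of the delay by the delay itself is nonnegative. -/
lemma third_derivative_factor_nonneg {s : ℕ} (hs : 1 ≤ s) {a : ℝ} (ha : 0 < a) (has : a < s) :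
    0 ≤ rate s a ^ 3 - 7 * rate s a ^ 2 * delay s a + 12 * rate s a * delay s a ^ 2
      - 6 * delay s a ^ 3 + (-s / a ^ 2 + 2 / (s - a) ^ 2) * (3 * rate s a - 4 * delay s a)
      + (2 * s / a ^ 3 + 4 / (s - a) ^ 3) := by
  have hsub : 0 < (s : ℝ) - a := by linarith
  -- In these variables `(s - a) * rate s a = x + 2` and `(s - a)²` times the derivative of `rate`
  -- is `2 - x (1 + r)`.
  have h := cubic_nonneg hs (x := (s - a) ^ 2 / a) (r := (s - a) / a) (C := (s - a) * delay s a)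
    (by positivity) (by field_simp; ring) (delay_bound hs ha has)
  refine nonneg_of_mul_nonneg_right (a := ((s : ℝ) - a) ^ 3) ?_ (by positivity)
  refine h.trans_eq ?_
  unfold rate
  generalize delay s a = d
  generalize (s : ℝ) = c at *
  have hsub' := hsub.ne'
  field_simp
  ring

lemma contDiffOn_delay (s : ℕ) : ContDiffOn ℝ (⊤ : ℕ∞) (delay s) {a | delayDenom s a ≠ 0} := by
  have h1 : ContDiff ℝ (⊤ : ℕ∞) (expSum s) := by unfold expSum; fun_prop
  have h2 : ContDiff ℝ (⊤ : ℕ∞) (delayDenom s) := by unfold delayDenom; fun_prop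
  exact ContDiffOn.div (by fun_prop) h2.contDiffOn fun a ha => ha

lemma isOpen_delayDenom_ne_zero (s : ℕ) : IsOpen {a | delayDenom s a ≠ 0} := by
  have : Continuous (delayDenom s) := by unfold delayDenom expSum; fun_prop
  exact isOpen_ne_fun this continuous_const

/-- The Riccati equation is iterated on the open interval only, as `s / a` has a pole at `0`; the
endpoint follows by continuity, `delay` being smooth near it. -/
lemma monotoneOn_deriv_deriv_delay {s : ℕ} (hs : 1 ≤ s) :
    MonotoneOn (deriv (deriv (delay s))) (Set.Ico 0 (s : ℝ)) := by
  have hU := isOpen_delayDenom_ne_zero s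
  have hsubset : Set.Ico 0 (s : ℝ) ⊆ {a | delayDenom s a ≠ 0} :=
    fun a ha => (delayDenom_pos hs ha.1 ha.2).ne'
  have h1 := (contDiffOn_delay s).deriv_of_isOpen (m := (⊤ : ℕ∞)) hU le_rfl
  have h2 := h1.deriv_of_isOpen (m := (⊤ : ℕ∞)) hU le_rfl
  have d1 : Set.EqOn (deriv (delay s)) (fun a => delay s a * (rate s a - delay s a))
      (Set.Ioo 0 (s : ℝ)) := fun a ha => (hasDerivAt_delay hs ha.1 ha.2).deriv
  have d2 : Set.EqOn (deriv (deriv (delay s))) (fun a => delay s a * (rate s a ^ 2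
      - 3 * rate s a * delay s a + 2 * delay s a ^ 2 + (-s / a ^ 2 + 2 / (s - a) ^ 2)))
      (Set.Ioo 0 (s : ℝ)) := fun a ha => by
    rw [(d1.eventuallyEq_of_mem (isOpen_Ioo.mem_nhds ha)).deriv_eq]
    have hd := hasDerivAt_delay hs ha.1 ha.2
    have hr := hasDerivAt_rate ha.1 ha.2
    refine ((hd.mul (hr.sub hd)).congr_deriv ?_).deriv
    simp only [Pi.sub_apply]
    ring
  have d3 : ∀ a ∈ Set.Ioo 0 (s : ℝ), 0 ≤ deriv (deriv (deriv (delay s))) a := fun a ha => by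
    rw [(d2.eventuallyEq_of_mem (isOpen_Ioo.mem_nhds ha)).deriv_eq]
    have hd := hasDerivAt_delay hs ha.1 ha.2
    have hr := hasDerivAt_rate ha.1 ha.2
    have hr2 := hasDerivAt_deriv_rate ha.1 ha.2
    have h3 := hd.mul ((((hr.pow 2).sub ((hr.const_mul 3).mul hd)).add
      ((hd.pow 2).const_mul 2)).add hr2)
    have hpos : 0 ≤ delay s a :=
      div_nonneg (div_nonneg (pow_nonneg ha.1.le _) (by positivity))
        (delayDenom_pos hs ha.1.le ha.2).le
    have h4 := mul_nonneg hpos (third_derivative_factor_nonneg hs ha.1 ha.2)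
    refine h4.trans_eq (HasDerivAt.deriv ?_).symm
    refine (h3.congr_deriv ?_).congr_of_eventuallyEq (Filter.Eventually.of_forall fun y => ?_)
    · simp only [Pi.add_apply, Pi.sub_apply, Pi.mul_apply, Pi.pow_apply]
      generalize (-s / a ^ 2 + 2 / (s - a) ^ 2) = u
      generalize (2 * s / a ^ 3 + 4 / (s - a) ^ 3) = v
      ring
    · simp only [Pi.add_apply, Pi.sub_apply, Pi.mul_apply, Pi.pow_apply]
  refine monotoneOn_of_deriv_nonneg (convex_Ico _ _) (h2.continuousOn.mono hsubset) ?_ ?_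
  · exact ((h2.differentiableOn (by simp)).mono (interior_subset.trans hsubset))
  · rw [interior_Ico]; exact d3

/-- In the stable region the mean waiting time is twice continuously differentiable, with monotone
second derivative. -/
lemma exists_monotoneOn_second_derivative {s : ℕ} (hs : 1 ≤ s) {μ : ℝ} (hμ : 0 < μ) :
    ∃ f f' f'' : ℝ → ℝ, Set.EqOn (W s μ) f (Set.Ico 0 (s * μ)) ∧
      (∀ x ∈ Set.Ico 0 (s * μ), HasDerivAt f (f' x) x) ∧
      (∀ x ∈ Set.Ico 0 (s * μ), HasDerivAt f' (f'' x) x) ∧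
      ContinuousOn f'' (Set.Ico 0 (s * μ)) ∧ MonotoneOn f'' (Set.Ico 0 (s * μ)) := by
  have hU := isOpen_delayDenom_ne_zero s
  have h0 := contDiffOn_delay s
  have h1 := h0.deriv_of_isOpen (m := (⊤ : ℕ∞)) hU le_rfl
  have h2 := h1.deriv_of_isOpen (m := (⊤ : ℕ∞)) hU le_rfl
  have hmem : ∀ x ∈ Set.Ico 0 (s * μ), x / μ ∈ Set.Ico 0 (s : ℝ) := fun x hx =>
    ⟨div_nonneg hx.1 hμ.le, (div_lt_iff₀ hμ).2 hx.2⟩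
  have hmem' : ∀ x ∈ Set.Ico 0 (s * μ), {a | delayDenom s a ≠ 0} ∈ nhds (x / μ) := fun x hx =>
    hU.mem_nhds (delayDenom_pos hs (hmem x hx).1 (hmem x hx).2).ne'
  have hdiv : ∀ x : ℝ, HasDerivAt (fun x => x / μ) (1 / μ) x := fun x => by
    simpa using (hasDerivAt_id x).div_const μ
  refine ⟨fun x => 1 / μ * (1 + delay s (x / μ)), fun x => 1 / μ * (deriv (delay s) (x / μ) * (1 / μ)),
    fun x => 1 / μ * (deriv (deriv (delay s)) (x / μ) * (1 / μ) * (1 / μ)), ?_, ?_, ?_, ?_, ?_⟩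
  · exact fun x hx => W_eq_delay hs hμ hx.1 hx.2
  · intro x hx
    have hd := ((h0.contDiffAt (hmem' x hx)).differentiableAt (by simp)).hasDerivAt
    exact ((hd.comp x (hdiv x)).const_add 1).const_mul (1 / μ)
  · intro x hx
    have hd := ((h1.contDiffAt (hmem' x hx)).differentiableAt (by simp)).hasDerivAt
    exact ((hd.comp x (hdiv x)).mul_const (1 / μ)).const_mul (1 / μ)
  · have hc : ContinuousOn (fun x => deriv (deriv (delay s)) (x / μ)) (Set.Ico 0 (s * μ)) :=
      h2.continuousOn.comp (by fun_prop) fun x hx => mem_of_mem_nhds (hmem' x hx)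
    fun_prop
  · intro x hx y hy hxy
    have := monotoneOn_deriv_deriv_delay hs (hmem x hx) (hmem y hy) (by gcongr)
    dsimp only
    gcongr

end MMs
end

/-! ### Densities of distributions with convex or concave distribution function -/

/-- If the integrals of `g` over the superlevel sets of a density are nonnegative, then so is the
integral of `g` with respect to the measure with this density. -/
lemma integral_withDensity_nonneg_of_superlevel {α : Type*} [MeasurableSpace α] {ν : Measure α}
    {f g : α → ℝ} (hf : Measurable f) (hf0 : ∀ x, 0 ≤ f x) (hg : Measurable g)
    (hgi : Integrable g ν)
    (hgf : Integrable g (ν.withDensity fun x => ENNReal.ofReal (f x)))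
    (h : ∀ t, 0 ≤ ∫ x in {x | t < f x}, g x ∂ν) :
    0 ≤ ∫ x, g x ∂(ν.withDensity fun x => ENNReal.ofReal (f x)) := by
  have hfm : Measurable fun x => ENNReal.ofReal (f x) := hf.ennreal_ofReal
  have key : ∀ k : α → ENNReal, Measurable k →
      ∫⁻ x, k x ∂(ν.withDensity fun x => ENNReal.ofReal (f x)) =
        ∫⁻ t in Set.Ioi (0 : ℝ), ∫⁻ x in {x | t < f x}, k x ∂ν := by
    intro k hk
    rw [lintegral_withDensity_eq_lintegral_mul _ hfm hk]
    -- The roles of density and integrand are swapped: the layer-cake formula is applied to `f`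
    -- under the measure with density `k`.
    have h1 := lintegral_withDensity_eq_lintegral_mul ν hk hfm
    rw [show (fun x => ENNReal.ofReal (f x)) * k = k * fun x => ENNReal.ofReal (f x) from
      mul_comm _ _, ← h1, lintegral_eq_lintegral_meas_lt _ (Filter.Eventually.of_forall hf0)
      hf.aemeasurable]
    refine lintegral_congr fun t => ?_
    exact withDensity_apply _ (measurableSet_lt measurable_const hf)
  rw [integral_eq_lintegral_pos_part_sub_lintegral_neg_part hgf, sub_nonneg]
  refine ENNReal.toReal_mono ?_ ?_
  · exact (hgf.lintegral_lt_top).ne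
  rw [key _ hg.ennreal_ofReal, key (fun x => ENNReal.ofReal (-g x)) hg.neg.ennreal_ofReal]
  refine lintegral_mono fun t => ?_
  have h2 := h t
  have hgt : Integrable g (ν.restrict {x | t < f x}) := hgi.restrict
  rw [integral_eq_lintegral_pos_part_sub_lintegral_neg_part hgt, sub_nonneg] at h2
  exact (ENNReal.toReal_le_toReal hgt.neg.lintegral_lt_top.ne hgt.lintegral_lt_top.ne).1 h2

/-- On an open set on which the distribution function is continuous and differentiable from the
right everywhere, the distribution has the right derivative as its density. -/
lemma restrict_eq_withDensity_derivWithin_cdf (P : Measure ℝ) [IsProbabilityMeasure P] {s : Set ℝ}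
    (hs : IsOpen s) (hc : ContinuousOn (cdf P) s)
    (hd : ∀ x ∈ s, DifferentiableWithinAt ℝ (cdf P) (Set.Ioi x) x) :
    P.restrict s = (volume.withDensity fun x =>
      ENNReal.ofReal (derivWithin (cdf P) (Set.Ioi x) x)).restrict s := by
  set f : ℝ → ℝ := fun x => derivWithin (cdf P) (Set.Ioi x) x with hf
  have hf0 : ∀ x, 0 ≤ f x := fun x => ((monotone_cdf P).monotoneOn _).derivWithin_nonneg
  set Q := volume.withDensity fun x => ENNReal.ofReal (f x) with hQ
  have hIoc : ∀ a b, a ≤ b → Set.Icc a b ⊆ s → P (Set.Ioc a b) = Q (Set.Ioc a b) := by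
    intro a b hab hsub
    have hcont := hc.mono hsub
    have hderiv : ∀ x ∈ Set.Ioo a b, HasDerivWithinAt (cdf P) (f x) (Set.Ioi x) x :=
      fun x hx => (hd x (hsub (Set.Ioo_subset_Icc_self hx))).hasDerivWithinAt
    have hint := intervalIntegral.integrableOn_deriv_right_of_nonneg hcont hderiv fun x _ => hf0 x
    have hftc := intervalIntegral.integral_eq_sub_of_hasDeriv_right_of_le hab hcont hderiv
      ((intervalIntegrable_iff_integrableOn_Ioc_of_le hab).2 hint)
    rw [intervalIntegral.integral_of_le hab] at hftc
    rw [hQ, withDensity_apply _ measurableSet_Ioc,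
      ← ofReal_integral_eq_lintegral_ofReal hint (Filter.Eventually.of_forall hf0), hftc]
    conv_lhs => rw [← measure_cdf P]
    rw [StieltjesFunction.measure_Ioc]
  have hres : ∀ a b, Set.Icc a b ⊆ s → P.restrict (Set.Ioc a b) = Q.restrict (Set.Ioc a b) := by
    intro a b hsub
    refine Measure.ext_of_Ioc _ _ fun c d _ => ?_
    rw [Measure.restrict_apply measurableSet_Ioc, Measure.restrict_apply measurableSet_Ioc,
      Set.Ioc_inter_Ioc]
    by_cases h : max c a ≤ min d b
    · exact hIoc _ _ h ((Set.Icc_subset_Icc (le_max_right _ _) (min_le_right _ _)).trans hsub)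
    · rw [Set.Ioc_eq_empty fun h' => h h'.le, measure_empty, measure_empty]
  -- Rational endpoints make the cover countable, so agreement on each piece gives agreement on `s`.
  have hU : s = ⋃ i : {q : ℚ × ℚ // Set.Icc (q.1 : ℝ) q.2 ⊆ s},
      Set.Ioc (i.1.1 : ℝ) (i.1.2 : ℝ) := by
    refine Set.Subset.antisymm (fun x hx => ?_)
      (Set.iUnion_subset fun i => Set.Ioc_subset_Icc_self.trans i.2)
    obtain ⟨ε, hε, hball⟩ := Metric.isOpen_iff.1 hs x hx
    obtain ⟨p, hp1, hp2⟩ := exists_rat_btwn (sub_lt_self x hε)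
    obtain ⟨q, hq1, hq2⟩ := exists_rat_btwn (lt_add_of_pos_right x hε)
    refine Set.mem_iUnion.2 ⟨⟨(p, q), fun y hy => hball ?_⟩, hp2, hq1.le⟩
    rw [Real.ball_eq_Ioo]
    exact ⟨hp1.trans_le hy.1, hy.2.trans_lt hq2⟩
  rw [hU, Measure.restrict_iUnion_congr]
  exact fun i => hres _ _ i.2

/-! ### The mode lies in the support -/

lemma cdf_eq_zero_of_lt {P : Measure ℝ} [IsProbabilityMeasure P] {lo hi x : ℝ}
    (hP : ∀ᵐ x ∂P, x ∈ Set.Icc lo hi) (hx : x < lo) : cdf P x = 0 := by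
  rw [cdf_eq_real, measureReal_eq_zero_iff]
  have hsub : Set.Iic x ⊆ {y | ¬ y ∈ Set.Icc lo hi} := fun y (hy : y ≤ x) h =>
    absurd (hy.trans_lt hx) (not_lt.2 h.1)
  exact measure_mono_null hsub (ae_iff.1 hP)

lemma cdf_eq_one_of_le {P : Measure ℝ} [IsProbabilityMeasure P] {lo hi x : ℝ}
    (hP : ∀ᵐ x ∂P, x ∈ Set.Icc lo hi) (hx : hi ≤ x) : cdf P x = 1 := by
  have : P (Set.Iic x) = 1 := by
    rw [prob_compl_eq_zero_iff measurableSet_Iic |>.symm]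
    have hsub : (Set.Iic x)ᶜ ⊆ {y | ¬ y ∈ Set.Icc lo hi} := fun y hy h => hy (h.2.trans hx)
    exact measure_mono_null hsub (ae_iff.1 hP)
  rw [cdf_eq_real, measureReal_def, this, ENNReal.toReal_one]

/-- With `M < lo` the distribution function would be flat and then rise in its concave region; with
`hi < M` it would rise and then be flat in its convex region. -/
lemma IsUnimodal.mode_mem_Icc {P : Measure ℝ} [IsProbabilityMeasure P] {lo hi M : ℝ}
    (hP : ∀ᵐ x ∂P, x ∈ Set.Icc lo hi) (hM : IsUnimodal P M) : M ∈ Set.Icc lo hi := by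
  obtain ⟨x₀, hx₀⟩ := hP.exists
  have hle : lo ≤ hi := hx₀.1.trans hx₀.2
  constructor
  · by_contra! h
    have := hM.2.slope_anti_adjacent (x := (2 * M + lo) / 3) (y := (M + 2 * lo) / 3) (z := hi)
      (by simp; linarith) (by simp; linarith) (by linarith) (by linarith)
    rw [cdf_eq_zero_of_lt hP (show (2 * M + lo) / 3 < lo by linarith),
      cdf_eq_zero_of_lt hP (show (M + 2 * lo) / 3 < lo by linarith), cdf_eq_one_of_le hP le_rfl, sub_self, zero_div, sub_zero] at this
    exact absurd this (not_le.2 (one_div_pos.2 (by linarith)))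
  · by_contra! h
    have := hM.1.slope_mono_adjacent (x := lo - 1) (y := hi) (z := (hi + M) / 2)
      (by simp; linarith) (by simp; linarith) (by linarith) (by linarith)
    rw [cdf_eq_zero_of_lt hP (sub_one_lt lo), cdf_eq_one_of_le hP le_rfl,
      cdf_eq_one_of_le hP (show hi ≤ (hi + M) / 2 by linarith), sub_self, zero_div, sub_zero] at this
    exact absurd this (not_le.2 (one_div_pos.2 (by linarith)))

/-! ### Integrals against unimodal distributions -/

/-- A subset of `(M, b]` closed under moving towards `M` is almost an interval. -/
lemma exists_ae_eq_Ioc_left {M b : ℝ} (hMb : M ≤ b) {A : Set ℝ} (hA : A ⊆ Set.Ioc M b)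
    (h : ∀ x ∈ A, ∀ y, M < y → y ≤ x → y ∈ A) :
    ∃ y ∈ Set.Icc M b, A =ᵐ[volume] Set.Ioc M y := by
  -- Inserting `M` makes the supremum equal to `M` when `A` is empty.
  have hub : b ∈ upperBounds (insert M A) := by
    rintro x (rfl | hx)
    exacts [hMb, (hA hx).2]
  refine ⟨sSup (insert M A), ⟨le_csSup ⟨b, hub⟩ (Set.mem_insert _ _),
    csSup_le (Set.insert_nonempty _ _) hub⟩, ?_⟩
  have hne : ∀ᵐ x : ℝ, x ≠ sSup (insert M A) := by simp [ae_iff]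
  refine Filter.eventuallyEq_set.2 ?_
  filter_upwards [hne] with x hx
  refine ⟨fun hxA => ⟨(hA hxA).1, le_csSup ⟨b, hub⟩ (Set.mem_insert_of_mem _ hxA)⟩, fun hx' => ?_⟩
  obtain ⟨z, hz, hxz⟩ := exists_lt_of_lt_csSup (Set.insert_nonempty _ _) (lt_of_le_of_ne hx'.2 hx)
  obtain rfl | hz := hz
  · exact absurd hxz hx'.1.not_gt
  · exact h z hz x hx'.1 hxz.le

/-- A subset of `[a, M)` closed under moving towards `M` is almost an interval. -/
lemma exists_ae_eq_Ioc_right {M a : ℝ} (haM : a ≤ M) {A : Set ℝ} (hA : A ⊆ Set.Ico a M)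
    (h : ∀ x ∈ A, ∀ y, y < M → x ≤ y → y ∈ A) :
    ∃ y ∈ Set.Icc a M, A =ᵐ[volume] Set.Ioc y M := by
  have hlb : a ∈ lowerBounds (insert M A) := by
    rintro x (rfl | hx)
    exacts [haM, (hA hx).1]
  refine ⟨sInf (insert M A), ⟨le_csInf (Set.insert_nonempty _ _) hlb,
    csInf_le ⟨a, hlb⟩ (Set.mem_insert _ _)⟩, ?_⟩
  have hne : ∀ᵐ x : ℝ, x ≠ sInf (insert M A) := by simp [ae_iff]
  have hne' : ∀ᵐ x : ℝ, x ≠ M := by simp [ae_iff]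
  refine Filter.eventuallyEq_set.2 ?_
  filter_upwards [hne, hne'] with x hx hxM
  refine ⟨fun hxA => ⟨lt_of_le_of_ne (csInf_le ⟨a, hlb⟩ (Set.mem_insert_of_mem _ hxA)) (Ne.symm hx),
    (hA hxA).2.le⟩, fun hx' => ?_⟩
  obtain ⟨z, hz, hzx⟩ := exists_lt_of_csInf_lt (Set.insert_nonempty _ _) hx'.1
  obtain rfl | hz := hz
  · exact absurd hx'.2 (not_le.2 hzx)
  · exact h z hz x (lt_of_le_of_ne hx'.2 hxM) hzx.le

lemma ConcaveOn.differentiableWithinAt_Ioi_of_isOpen {F : ℝ → ℝ} {s : Set ℝ} (hs : IsOpen s)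
    (hF : ConcaveOn ℝ s F) {x : ℝ} (hx : x ∈ s) : DifferentiableWithinAt ℝ F (Set.Ioi x) x := by
  have := hF.neg.differentiableWithinAt_Ioi_of_mem_interior (by rwa [hs.interior_eq])
  simpa using this.neg

lemma ConcaveOn.antitoneOn_derivWithin_Ioi {F : ℝ → ℝ} {s : Set ℝ} (hs : IsOpen s)
    (hF : ConcaveOn ℝ s F) : AntitoneOn (fun x => derivWithin F (Set.Ioi x) x) s := by
  have := hF.neg.monotoneOn_rightDeriv
  rw [hs.interior_eq] at this
  intro x hx y hy hxy
  have h := this hx hy hxy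
  simp only [derivWithin.neg] at h
  exact neg_le_neg_iff.1 h

/-- A continuous function whose integrals over all intervals with one end at the mode of a unimodal
distribution are nonnegative has a nonnegative integral with respect to the distribution. -/
lemma IsUnimodal.integral_nonneg {P : Measure ℝ} [IsProbabilityMeasure P] {lo hi M : ℝ}
    (hP : ∀ᵐ x ∂P, x ∈ Set.Icc lo hi) (hM : IsUnimodal P M) {g : ℝ → ℝ} (hg : Continuous g)
    (hgM : 0 ≤ g M) (hr : ∀ y ∈ Set.Icc M hi, 0 ≤ ∫ x in M..y, g x)
    (hl : ∀ y ∈ Set.Icc lo M, 0 ≤ ∫ x in y..M, g x) : 0 ≤ ∫ x, g x ∂P := by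
  have hmem := hM.mode_mem_Icc hP
  set f : ℝ → ℝ := fun x => derivWithin (cdf P) (Set.Ioi x) x with hf
  have hf0 : ∀ x, 0 ≤ f x := fun x => ((monotone_cdf P).monotoneOn _).derivWithin_nonneg
  have hfm : Measurable f := measurable_derivWithin_Ioi _
  have hloc : ∀ a b, IntegrableOn g (Set.Icc a b) P := fun a b =>
    hg.continuousOn.integrableOn_compact isCompact_Icc
  have hlocv : ∀ a b, IntegrableOn g (Set.Icc a b) volume := fun a b =>
    hg.continuousOn.integrableOn_compact isCompact_Icc
  have side : ∀ s t : Set ℝ, MeasurableSet t → t ⊆ Set.Icc lo hi → t ⊆ s →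
      P.restrict s = (volume.withDensity fun x => ENNReal.ofReal (f x)).restrict s →
      (∀ u, 0 ≤ ∫ x in {x | u < f x} ∩ t, g x) → 0 ≤ ∫ x in t, g x ∂P := by
    intro s t ht htI hts hst hu
    have h1 : P.restrict t = (volume.restrict t).withDensity fun x => ENNReal.ofReal (f x) := by
      rw [← restrict_withDensity ht, ← Measure.restrict_restrict_of_subset hts, hst,
        Measure.restrict_restrict_of_subset hts]
    have h2 : Integrable g (P.restrict t) := (hloc lo hi).mono_set htI
    rw [h1] at h2 ⊢
    refine integral_withDensity_nonneg_of_superlevel hfm hf0 hg.measurable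
      ((hlocv lo hi).mono_set htI) h2 fun u => ?_
    rw [Measure.restrict_restrict (measurableSet_lt measurable_const hfm)]
    exact hu u
  have hright : 0 ≤ ∫ x in Set.Ioc M hi, g x ∂P := by
    refine side (Set.Ioi M) _ measurableSet_Ioc
      ((Set.Ioc_subset_Icc_self).trans (Set.Icc_subset_Icc_left hmem.1)) Set.Ioc_subset_Ioi_self
      (restrict_eq_withDensity_derivWithin_cdf P isOpen_Ioi (hM.2.continuousOn isOpen_Ioi)
        fun x hx => hM.2.differentiableWithinAt_Ioi_of_isOpen isOpen_Ioi hx) fun u => ?_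
    obtain ⟨y, hy, hAy⟩ := exists_ae_eq_Ioc_left hmem.2
      (A := {x | u < f x} ∩ Set.Ioc M hi) Set.inter_subset_right fun x hx y hy hyx =>
        ⟨lt_of_lt_of_le hx.1 (hM.2.antitoneOn_derivWithin_Ioi isOpen_Ioi hy hx.2.1 hyx),
          hy, hyx.trans hx.2.2⟩
    rw [setIntegral_congr_set hAy, ← intervalIntegral.integral_of_le hy.1]
    exact hr y hy
  have hleft : 0 ≤ ∫ x in Set.Ico lo M, g x ∂P := by
    refine side (Set.Iio M) _ measurableSet_Ico
      ((Set.Ico_subset_Icc_self).trans (Set.Icc_subset_Icc_right hmem.2)) Set.Ico_subset_Iio_self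
      (restrict_eq_withDensity_derivWithin_cdf P isOpen_Iio (hM.1.continuousOn isOpen_Iio)
        fun x hx => hM.1.differentiableWithinAt_Ioi_of_mem_interior (by rwa [interior_Iio]))
      fun u => ?_
    have hmono := hM.1.monotoneOn_rightDeriv
    rw [interior_Iio] at hmono
    obtain ⟨y, hy, hAy⟩ := exists_ae_eq_Ioc_right hmem.1
      (A := {x | u < f x} ∩ Set.Ico lo M) Set.inter_subset_right fun x hx y hy hxy =>
        ⟨lt_of_lt_of_le hx.1 (hmono hx.2.2 hy hxy), hx.2.1.trans hxy, hy⟩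
    rw [setIntegral_congr_set hAy, ← intervalIntegral.integral_of_le hy.2]
    exact hl y hy
  have hI : ∫ x, g x ∂P = ∫ x in Set.Icc lo hi, g x ∂P := by
    rw [Measure.restrict_eq_self_of_ae_mem hP]
  -- The possible atom at the mode is not seen by the density.
  have hmid : 0 ≤ ∫ x in ({M} : Set ℝ), g x ∂P := by
    rw [integral_singleton]
    exact smul_nonneg ENNReal.toReal_nonneg hgM
  rw [hI, ← Set.Icc_union_Ioc_eq_Icc hmem.1 hmem.2,
    setIntegral_union (Set.disjoint_left.2 fun x hx hx' => hx'.1.not_ge hx.2) measurableSet_Ioc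
      (hloc _ _) ((hloc M hi).mono_set Set.Ioc_subset_Icc_self),
    ← Set.Ico_union_right hmem.1, setIntegral_union (by simp) (measurableSet_singleton _)
      ((hloc lo M).mono_set Set.Ico_subset_Icc_self)
      ((hloc lo M).mono_set (by simpa using hmem.1))]
  positivity

noncomputable section

/-! ### Uniform distributions with one end at the mode -/

/-- The mean of `g` over the segment from `M` to `M + z`. -/
def segmentMean (g : ℝ → ℝ) (M z : ℝ) : ℝ := ∫ u in (0 : ℝ)..1, g (M + z * u)

lemma mul_segmentMean (g : ℝ → ℝ) (M z : ℝ) : z * segmentMean g M z = ∫ t in M..(M + z), g t := by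
  simp [segmentMean]

lemma Wstar_eq_segmentMean (s : ℕ) (μ M z : ℝ) :
    Wstar s μ M z = segmentMean (MMs.W s μ) M z := by
  unfold Wstar
  split_ifs with h
  · simp [segmentMean, h]
  · rw [add_comm z M, ← mul_segmentMean]
    field_simp

lemma segment_mem_Icc {lo hi M z u : ℝ} (hM : M ∈ Set.Icc lo hi) (hz : M + z ∈ Set.Icc lo hi)
    (hu : u ∈ Set.Icc (0 : ℝ) 1) : M + z * u ∈ Set.Icc lo hi := by
  have h := (convex_Icc lo hi) hM hz (sub_nonneg.2 hu.2) hu.1 (by ring)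
  simp only [smul_eq_mul] at h
  convert h using 1
  ring

lemma segmentMean_congr {f g : ℝ → ℝ} {lo hi M z : ℝ} (hM : M ∈ Set.Icc lo hi)
    (hz : M + z ∈ Set.Icc lo hi) (h : Set.EqOn f g (Set.Icc lo hi)) :
    segmentMean f M z = segmentMean g M z := by
  refine intervalIntegral.integral_congr fun u hu => h (segment_mem_Icc hM hz ?_)
  rwa [Set.uIcc_of_le zero_le_one] at hu

/-- The factors 2 and 3 cancel the means 1/2 and 1/3 of `u` and `u²` over `[0, 1]`, so every
quadratic in `z` is a segment mean. -/
lemma segmentMean_quadratic (A B C M z : ℝ) :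
    segmentMean (fun x => A + 2 * B * (x - M) + 3 * C * (x - M) ^ 2) M z =
      A + B * z + C * z ^ 2 := by
  have h : ∀ u ∈ Set.uIcc (0 : ℝ) 1, HasDerivAt
      (fun u => A * u + B * z * u ^ 2 + C * z ^ 2 * u ^ 3)
      (A + 2 * B * (M + z * u - M) + 3 * C * (M + z * u - M) ^ 2) u := fun u _ => by
    refine ((((hasDerivAt_id u).const_mul A).add ((hasDerivAt_pow 2 u).const_mul (B * z))).add
      ((hasDerivAt_pow 3 u).const_mul (C * z ^ 2))).congr_deriv ?_
    push_cast
    ring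
  unfold segmentMean
  rw [intervalIntegral.integral_eq_sub_of_hasDerivAt h
    (Continuous.intervalIntegrable (by fun_prop) _ _)]
  ring

lemma segmentMean_sub {f g : ℝ → ℝ} (hf : Continuous f) (hg : Continuous g) (M z : ℝ) :
    segmentMean (fun x => f x - g x) M z = segmentMean f M z - segmentMean g M z :=
  intervalIntegral.integral_sub (Continuous.intervalIntegrable (by fun_prop) _ _)
    (Continuous.intervalIntegrable (by fun_prop) _ _)

/-- The uniform distribution on the segment from `M` to `M + z`, a Dirac mass if `z = 0`. -/
def segmentLaw (M z : ℝ) : Measure ℝ :=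
  (volume.restrict (Set.Icc (0 : ℝ) 1)).map fun u => M + z * u

lemma measurable_segment (M z : ℝ) : Measurable fun u : ℝ => M + z * u := by fun_prop

instance isProbabilityMeasure_segmentLaw (M z : ℝ) : IsProbabilityMeasure (segmentLaw M z) := by
  have : IsProbabilityMeasure (volume.restrict (Set.Icc (0 : ℝ) 1)) := ⟨by simp⟩
  exact Measure.isProbabilityMeasure_map (measurable_segment M z).aemeasurable

lemma integral_segmentLaw {g : ℝ → ℝ} (hg : Continuous g) (M z : ℝ) :
    ∫ x, g x ∂(segmentLaw M z) = segmentMean g M z := by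
  rw [segmentLaw, integral_map (measurable_segment M z).aemeasurable hg.aestronglyMeasurable,
    segmentMean, intervalIntegral.integral_of_le zero_le_one, integral_Icc_eq_integral_Ioc]

lemma ae_segmentLaw_mem_Icc {lo hi M z : ℝ} (hM : M ∈ Set.Icc lo hi)
    (hz : M + z ∈ Set.Icc lo hi) : ∀ᵐ x ∂(segmentLaw M z), x ∈ Set.Icc lo hi := by
  refine (ae_map_iff (p := fun x => x ∈ Set.Icc lo hi) (measurable_segment M z).aemeasurable
    measurableSet_Icc).2 ?_
  filter_upwards [ae_restrict_mem measurableSet_Icc] with u hu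
  exact segment_mem_Icc hM hz hu

lemma cdf_segmentLaw (M z x : ℝ) :
    cdf (segmentLaw M z) x = volume.real ({u | M + z * u ≤ x} ∩ Set.Icc (0 : ℝ) 1) := by
  rw [cdf_eq_real, measureReal_def, measureReal_def, segmentLaw,
    Measure.map_apply (measurable_segment M z) measurableSet_Iic,
    Measure.restrict_apply (measurable_segment M z measurableSet_Iic)]
  rfl

/-- On the side of `M` containing the segment the distribution function is an affine function
clipped at 0 or 1; on the other side it is constant. -/
lemma isUnimodal_segmentLaw (M z : ℝ) : IsUnimodal (segmentLaw M z) M := by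
  constructor
  · rcases le_or_gt 0 z with hz | hz
    · refine (convexOn_const 0 (convex_Iio M)).congr fun x (hx : x < M) => ?_
      have : {u | M + z * u ≤ x} ∩ Set.Icc (0 : ℝ) 1 = ∅ := by
        refine Set.eq_empty_of_forall_notMem fun u hu => ?_
        have h1 : M + z * u ≤ x := hu.1
        have := mul_nonneg hz hu.2.1
        linarith
      rw [cdf_segmentLaw, this, measureReal_empty]
    · have hconv : ConvexOn ℝ (Set.Iio M) fun x => max ((-1 / z) * x + (1 + M / z)) 0 :=
        (((LinearMap.mul ℝ ℝ (-1 / z)).convexOn (convex_Iio M)).add_const _).sup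
          (convexOn_const 0 (convex_Iio M))
      refine hconv.congr fun x (hx : x < M) => ?_
      have : {u | M + z * u ≤ x} ∩ Set.Icc (0 : ℝ) 1 = Set.Icc ((x - M) / z) 1 := by
        ext u
        simp only [Set.mem_inter_iff, Set.mem_ofPred_eq, Set.mem_Icc, div_le_iff_of_neg hz]
        have h0 : 0 ≤ (x - M) / z := div_nonneg_of_nonpos (by linarith) hz.le
        constructor
        · rintro ⟨h1, h2, h3⟩
          exact ⟨by linarith, h3⟩
        · rintro ⟨h1, h3⟩
          exact ⟨by linarith, h0.trans ((div_le_iff_of_neg hz).2 h1), h3⟩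
      rw [cdf_segmentLaw, this, Real.volume_real_Icc,
        show 1 - (x - M) / z = (-1 / z) * x + (1 + M / z) by ring]
  · rcases le_or_gt z 0 with hz | hz
    · refine (concaveOn_const 1 (convex_Ioi M)).congr fun x (hx : M < x) => ?_
      have : {u | M + z * u ≤ x} ∩ Set.Icc (0 : ℝ) 1 = Set.Icc 0 1 := by
        refine Set.inter_eq_right.2 fun u hu => ?_
        have := mul_nonpos_of_nonpos_of_nonneg hz hu.1
        show M + z * u ≤ x
        linarith
      rw [cdf_segmentLaw, this, Real.volume_real_Icc]
      simp
    · have hconc : ConcaveOn ℝ (Set.Ioi M) fun x => min 1 ((1 / z) * x + (-M / z)) :=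
        (concaveOn_const 1 (convex_Ioi M)).inf
          (((LinearMap.mul ℝ ℝ (1 / z)).concaveOn (convex_Ioi M)).add_const _)
      refine hconc.congr fun x (hx : M < x) => ?_
      have : {u | M + z * u ≤ x} ∩ Set.Icc (0 : ℝ) 1 = Set.Icc 0 (min 1 ((x - M) / z)) := by
        ext u
        simp only [Set.mem_inter_iff, Set.mem_ofPred_eq, Set.mem_Icc, le_min_iff, le_div_iff₀ hz]
        constructor
        · rintro ⟨h1, h2, h3⟩
          exact ⟨h2, h3, by linarith⟩
        · rintro ⟨h2, h3, h1⟩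
          exact ⟨by linarith, h2, h3⟩
      have h0 : 0 ≤ (x - M) / z := div_nonneg (by linarith) hz.le
      rw [cdf_segmentLaw, this, Real.volume_real_Icc_of_le (le_min zero_le_one h0), sub_zero,
        show (x - M) / z = (1 / z) * x + (-M / z) by ring]

/-! ### Mixtures -/

/-- The mixture of two distributions with weights `1 - p` and `p`. -/
def mixture (p : ℝ) (P Q : Measure ℝ) : Measure ℝ :=
  ENNReal.ofReal (1 - p) • P + ENNReal.ofReal p • Q

lemma isProbabilityMeasure_mixture {p : ℝ} (hp0 : 0 ≤ p) (hp1 : p ≤ 1) (P Q : Measure ℝ)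
    [IsProbabilityMeasure P] [IsProbabilityMeasure Q] : IsProbabilityMeasure (mixture p P Q) := by
  refine ⟨?_⟩
  simp only [mixture, Measure.coe_add, Measure.coe_smul, Pi.add_apply, Pi.smul_apply, measure_univ,
    smul_eq_mul, mul_one]
  rw [← ENNReal.ofReal_add (sub_nonneg.2 hp1) hp0, sub_add_cancel, ENNReal.ofReal_one]

lemma ae_mixture {p : ℝ} {P Q : Measure ℝ} {q : ℝ → Prop} (hP : ∀ᵐ x ∂P, q x)
    (hQ : ∀ᵐ x ∂Q, q x) : ∀ᵐ x ∂(mixture p P Q), q x := by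
  rw [mixture, ae_add_measure_iff]
  exact ⟨Measure.ae_smul_measure hP _, Measure.ae_smul_measure hQ _⟩

lemma integral_mixture {p : ℝ} (hp0 : 0 ≤ p) (hp1 : p ≤ 1) {P Q : Measure ℝ} {g : ℝ → ℝ}
    (hP : Integrable g P) (hQ : Integrable g Q) :
    ∫ x, g x ∂(mixture p P Q) = (1 - p) * ∫ x, g x ∂P + p * ∫ x, g x ∂Q := by
  rw [mixture, integral_add_measure (hP.smul_measure ENNReal.ofReal_ne_top)
    (hQ.smul_measure ENNReal.ofReal_ne_top), integral_smul_measure, integral_smul_measure,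
    ENNReal.toReal_ofReal (sub_nonneg.2 hp1), ENNReal.toReal_ofReal hp0, smul_eq_mul, smul_eq_mul]

lemma IsUnimodal.mixture {p M : ℝ} (hp0 : 0 ≤ p) (hp1 : p ≤ 1) {P Q : Measure ℝ}
    [IsProbabilityMeasure P] [IsProbabilityMeasure Q] (hP : IsUnimodal P M)
    (hQ : IsUnimodal Q M) : IsUnimodal (mixture p P Q) M := by
  have := isProbabilityMeasure_mixture hp0 hp1 P Q
  have h : (cdf (_root_.mixture p P Q) : ℝ → ℝ) = (1 - p) • (cdf P : ℝ → ℝ) + p • (cdf Q : ℝ → ℝ) := by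
    funext x
    simp only [Pi.add_apply, Pi.smul_apply, smul_eq_mul, cdf_eq_real]
    simp only [measureReal_def, _root_.mixture, Measure.coe_add, Measure.coe_smul, Pi.add_apply,
      Pi.smul_apply, smul_eq_mul]
    rw [ENNReal.toReal_add (by finiteness) (by finiteness), ENNReal.toReal_mul, ENNReal.toReal_mul,
      ENNReal.toReal_ofReal (sub_nonneg.2 hp1), ENNReal.toReal_ofReal hp0]
  unfold IsUnimodal
  rw [h]
  exact ⟨(hP.1.smul (sub_nonneg.2 hp1)).add (hQ.1.smul hp0),
    (hP.2.smul (sub_nonneg.2 hp1)).add (hQ.2.smul hp0)⟩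

/-! ### Bounds through quadratic functions -/

lemma integrable_of_ae_mem_Icc {P : Measure ℝ} [IsFiniteMeasure P] {lo hi : ℝ}
    (hP : ∀ᵐ x ∂P, x ∈ Set.Icc lo hi) {g : ℝ → ℝ} (hg : Continuous g) : Integrable g P := by
  have h : IntegrableOn g (Set.Icc lo hi) P := hg.continuousOn.integrableOn_compact isCompact_Icc
  rwa [IntegrableOn, Measure.restrict_eq_self_of_ae_mem hP] at h

/-- A quadratic majorant of the segment means of `w` bounds the mean of `w` under every unimodal
distribution in terms of the first two moments. -/
lemma integral_le_of_segmentMean_le {m σ M lo hi : ℝ} {P : Measure ℝ}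
    (hP : P ∈ unimodalAmbiguitySet m σ M lo hi) {w : ℝ → ℝ} (hw : Continuous w) {A B C : ℝ}
    (h : ∀ z, M + z ∈ Set.Icc lo hi → segmentMean w M z ≤ A + B * z + C * z ^ 2) :
    ∫ x, w x ∂P ≤ A + B * (2 * (m - M)) + C * (3 * (σ ^ 2 + (m - M) ^ 2)) := by
  obtain ⟨hprob, hsupp, hmean, hsq, huni⟩ := hP
  have hM := huni.mode_mem_Icc hsupp
  set q : ℝ → ℝ := fun x => A + 2 * B * (x - M) + 3 * C * (x - M) ^ 2 with hq
  have hqc : Continuous q := by fun_prop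
  have hseg : ∀ z, M + z ∈ Set.Icc lo hi → 0 ≤ segmentMean (fun x => q x - w x) M z := fun z hz => by
    rw [segmentMean_sub hqc hw, segmentMean_quadratic, sub_nonneg]
    exact h z hz
  have h0 : 0 ≤ ∫ x, (q x - w x) ∂P := by
    refine huni.integral_nonneg hsupp (by fun_prop) ?_ (fun y hy => ?_) fun y hy => ?_
    · simpa [segmentMean] using hseg 0 (by simpa using hM)
    · have := mul_segmentMean (fun x => q x - w x) M (y - M)
      rw [add_sub_cancel] at this
      rw [← this]
      exact mul_nonneg (sub_nonneg.2 hy.1)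
        (hseg _ (by rw [add_sub_cancel]; exact ⟨hM.1.trans hy.1, hy.2⟩))
    · have := mul_segmentMean (fun x => q x - w x) M (y - M)
      rw [add_sub_cancel] at this
      -- Here `z = y - M ≤ 0`, and reversing the orientation restores the sign.
      rw [intervalIntegral.integral_symm, ← this, ← neg_mul]
      exact mul_nonneg (by linarith [hy.2])
        (hseg _ (by rw [add_sub_cancel]; exact ⟨hy.1, hy.2.trans hM.2⟩))
  have hi1 : Integrable (fun x : ℝ => x) P := integrable_of_ae_mem_Icc hsupp continuous_id
  have hi2 : Integrable (fun x : ℝ => x ^ 2) P := integrable_of_ae_mem_Icc hsupp (by fun_prop)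
  rw [integral_sub (integrable_of_ae_mem_Icc hsupp hqc) (integrable_of_ae_mem_Icc hsupp hw),
    sub_nonneg] at h0
  refine h0.trans_eq ?_
  have hexp : ∀ x, q x = (A - 2 * B * M + 3 * C * M ^ 2) + ((2 * B - 6 * C * M) * x + 3 * C * x ^ 2) :=
    fun x => by simp only [hq]; ring
  simp_rw [hexp]
  have hi12 : Integrable (fun x => (2 * B - 6 * C * M) * x + 3 * C * x ^ 2) P :=
    (hi1.const_mul _).add (hi2.const_mul _)
  rw [integral_add (integrable_const _) hi12,
    integral_add (hi1.const_mul _) (hi2.const_mul _), integral_const_mul, integral_const_mul, hmean,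
    hsq, integral_const, probReal_univ]
  simp only [smul_eq_mul]
  ring

end

/-! ### The majorizing quadratic, the extremal mixture and the tight bound -/

/-- Segment means of a function with monotone second derivative lie below the quadratic polynomial
that touches them at `l` and meets them at `b`. -/
lemma segmentMean_le_hermite {f f' f'' : ℝ → ℝ} {I : Set ℝ} (hI : I.OrdConnected)
    (hf : ∀ x ∈ I, HasDerivAt f (f' x) x) (hf' : ∀ x ∈ I, HasDerivAt f' (f'' x) x)
    (hc : ContinuousOn f'' I) (hm : MonotoneOn f'' I) {M l b z : ℝ} (hM : M ∈ I)
    (hl : M + l ∈ I) (hb : M + b ∈ I) (hz : M + z ∈ I) (hzb : z ≤ b) :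
    (segmentMean f M z - segmentMean f M l
        - (∫ u in (0 : ℝ)..1, u * f' (M + l * u)) * (z - l)) * (b - l) ^ 2 ≤
      (segmentMean f M b - segmentMean f M l
        - (∫ u in (0 : ℝ)..1, u * f' (M + l * u)) * (b - l)) * (z - l) ^ 2 := by
  have hmem : ∀ y, M + y ∈ I → ∀ u ∈ Set.Icc (0 : ℝ) 1, M + y * u ∈ I := by
    intro y hy u hu
    have h := hI.convex hM hy (sub_nonneg.2 hu.2) hu.1 (by ring)
    simp only [smul_eq_mul] at h
    convert h using 1
    ring
  have hfc : ContinuousOn f I := fun x hx => (hf x hx).continuousAt.continuousWithinAt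
  have hfc' : ContinuousOn f' I := fun x hx => (hf' x hx).continuousAt.continuousWithinAt
  have hint : ∀ y, M + y ∈ I → IntervalIntegrable (fun u => f (M + y * u)) volume 0 1 := by
    intro y hy
    refine ContinuousOn.intervalIntegrable ?_
    rw [Set.uIcc_of_le zero_le_one]
    exact hfc.comp (by fun_prop) (hmem y hy)
  have hint' : IntervalIntegrable (fun u => u * f' (M + l * u)) volume 0 1 := by
    refine ContinuousOn.intervalIntegrable ?_
    rw [Set.uIcc_of_le zero_le_one]
    exact continuousOn_id.mul (hfc'.comp (by fun_prop) (hmem l hl))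
  have hrem : ∀ y, M + y ∈ I → IntervalIntegrable
      (fun u => f (M + y * u) - f (M + l * u) - u * f' (M + l * u) * (y - l)) volume 0 1 :=
    fun y hy => ((hint y hy).sub (hint l hl)).sub (hint'.mul_const _)
  have heq : ∀ y, M + y ∈ I → segmentMean f M y - segmentMean f M l
      - (∫ u in (0 : ℝ)..1, u * f' (M + l * u)) * (y - l) =
      ∫ u in (0 : ℝ)..1, (f (M + y * u) - f (M + l * u) - u * f' (M + l * u) * (y - l)) := by
    intro y hy
    rw [intervalIntegral.integral_sub ((hint y hy).sub (hint l hl)) (hint'.mul_const _),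
      intervalIntegral.integral_sub (hint y hy) (hint l hl), intervalIntegral.integral_mul_const]
    rfl
  rw [heq z hz, heq b hb, ← intervalIntegral.integral_mul_const,
    ← intervalIntegral.integral_mul_const]
  refine intervalIntegral.integral_mono_on zero_le_one ((hrem z hz).mul_const _)
    ((hrem b hb).mul_const _) fun u hu => ?_
  -- For fixed `u` the three points are `M` plus `u` times `z`, `l`, `b`, so the pointwise Hermite
  -- inequality carries a factor `u²`, cancelled for `u > 0`; at `u = 0` both sides vanish.
  rcases hu.1.eq_or_lt with rfl | hu0
  · simp
  · have h := le_hermite_of_monotoneOn hI hf hf' hc hm (hmem z hz u hu) (hmem l hl u hu)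
      (hmem b hb u hu) (by nlinarith)
    refine le_of_mul_le_mul_left ?_ (pow_pos hu0 2)
    linear_combination h

/-- The second moment bound for the mixing distribution of a unimodal distribution, its variance
being nonnegative, and its mean lying to the left of the right end of its support. -/
lemma moment_bounds {m σ M lo hi : ℝ} {P : Measure ℝ}
    (hP : P ∈ unimodalAmbiguitySet m σ M lo hi) :
    0 ≤ hi + M - 2 * m ∧ 0 ≤ 3 * σ ^ 2 - (m - M) ^ 2 ∧
      3 * σ ^ 2 - (m - M) ^ 2 ≤ (2 * m - M - lo) * (hi + M - 2 * m) := by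
  have key : ∀ A B C : ℝ, (∀ z, M + z ∈ Set.Icc lo hi → 0 ≤ A + B * z + C * z ^ 2) →
      0 ≤ A + B * (2 * (m - M)) + C * (3 * (σ ^ 2 + (m - M) ^ 2)) := fun A B C h => by
    simpa using integral_le_of_segmentMean_le hP (w := fun _ => 0) continuous_const
      (A := A) (B := B) (C := C) fun z hz => by simpa [segmentMean] using h z hz
  refine ⟨?_, ?_, ?_⟩
  -- The three test quadratics are the distance to the right end, the squared deviation from the
  -- mean, and the product of the distances to both ends.
  · have := key (hi - M) (-1) 0 fun z hz => by linarith [hz.2]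
    linarith
  · have := key ((2 * (m - M)) ^ 2) (-2 * (2 * (m - M))) 1 fun z _ => by
      nlinarith [sq_nonneg (z - 2 * (m - M))]
    linarith
  · have := key (-(lo - M) * (hi - M)) (lo - M + (hi - M)) (-1) fun z hz => by
      nlinarith [mul_nonneg (sub_nonneg.2 hz.1) (sub_nonneg.2 hz.2)]
    linarith

/-- The mixture of two uniform distributions with the prescribed moments. -/
lemma mixture_mem_unimodalAmbiguitySet {m σ M lo hi l₁ l₂ p : ℝ} (hM : M ∈ Set.Icc lo hi)
    (h₁ : M + l₁ ∈ Set.Icc lo hi) (h₂ : M + l₂ ∈ Set.Icc lo hi) (hp0 : 0 ≤ p) (hp1 : p ≤ 1)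
    (hmean : (1 - p) * l₁ + p * l₂ = 2 * (m - M))
    (hsq : (1 - p) * l₁ ^ 2 + p * l₂ ^ 2 = 3 * (σ ^ 2 + (m - M) ^ 2)) :
    mixture p (segmentLaw M l₁) (segmentLaw M l₂) ∈ unimodalAmbiguitySet m σ M lo hi := by
  have s₁ := ae_segmentLaw_mem_Icc hM h₁
  have s₂ := ae_segmentLaw_mem_Icc hM h₂
  have hint : ∀ g : ℝ → ℝ, Continuous g →
      ∫ x, g x ∂(mixture p (segmentLaw M l₁) (segmentLaw M l₂)) =
        (1 - p) * segmentMean g M l₁ + p * segmentMean g M l₂ := fun g hg => by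
    rw [integral_mixture hp0 hp1 (integrable_of_ae_mem_Icc s₁ hg) (integrable_of_ae_mem_Icc s₂ hg),
      integral_segmentLaw hg, integral_segmentLaw hg]
  refine ⟨isProbabilityMeasure_mixture hp0 hp1 _ _, ae_mixture s₁ s₂, ?_, ?_,
    (isUnimodal_segmentLaw M l₁).mixture hp0 hp1 (isUnimodal_segmentLaw M l₂)⟩
  · have e : ∀ z, segmentMean (fun x => x) M z = M + z / 2 := fun z => by
      rw [show (fun x : ℝ => x) = fun x => M + 2 * (1 / 2) * (x - M) + 3 * 0 * (x - M) ^ 2 by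
        funext x; ring, segmentMean_quadratic]
      ring
    rw [hint _ continuous_id', e, e]
    linear_combination hmean / 2
  · have e : ∀ z, segmentMean (fun x => x ^ 2) M z = M ^ 2 + M * z + z ^ 2 / 3 := fun z => by
      rw [show (fun x : ℝ => x ^ 2) =
        fun x => M ^ 2 + 2 * M * (x - M) + 3 * (1 / 3) * (x - M) ^ 2 by
        funext x; ring, segmentMean_quadratic]
      ring
    rw [hint _ (by fun_prop), e, e]
    linear_combination M * hmean + hsq / 3

/-- Tight upper bound for the expected waiting time in the M/M/s queue whose random arrival rate is
unimodal with known mode `M`, mean `m`, variance `σ ^ 2` and support contained in `[lo, hi]`. -/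
theorem theorem2 (s : ℕ) (hs : 1 ≤ s) (μ : ℝ) (hμ : 0 < μ)
    (lo hi m σ M : ℝ) (hlo : 0 ≤ lo) (hstab : hi < s * μ)
    (hfeas : (unimodalAmbiguitySet m σ M lo hi).Nonempty)
    (hdeg : hi + M - 2 * m ≠ 0)
    (l₁ l₂ p : ℝ)
    (hl₁ : l₁ = 2 * m - 2 * M - (3 * σ ^ 2 - (m - M) ^ 2) / (hi + M - 2 * m))
    (hl₂ : l₂ = hi - M)
    (hp : p = (3 * σ ^ 2 - (m - M) ^ 2) /
      (3 * σ ^ 2 - (m - M) ^ 2 + (hi + M - 2 * m) ^ 2)) :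
    (∀ P ∈ unimodalAmbiguitySet m σ M lo hi, Integrable (fun x => MMs.W s μ x) P) ∧
    IsGreatest ((fun P : Measure ℝ => ∫ x, MMs.W s μ x ∂P) '' unimodalAmbiguitySet m σ M lo hi)
      ((1 - p) * Wstar s μ M l₁ + p * Wstar s μ M l₂) := by

  obtain ⟨f, f', f'', hWf, hf, hf', hc, hm⟩ := MMs.exists_monotoneOn_second_derivative hs hμ
  obtain ⟨P₀, hP₀⟩ := hfeas
  have hM : M ∈ Set.Icc lo hi := by
    have := hP₀.1
    exact hP₀.2.2.2.2.mode_mem_Icc hP₀.2.1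
  have hlohi : lo ≤ hi := hM.1.trans hM.2
  obtain ⟨hd0, hV, hVle⟩ := moment_bounds hP₀
  have hI : Set.Icc lo hi ⊆ Set.Ico 0 (s * μ) := fun x hx =>
    ⟨hlo.trans hx.1, hx.2.trans_lt hstab⟩
  set d := hi + M - 2 * m with hd
  set V := 3 * σ ^ 2 - (m - M) ^ 2 with hVdef
  have hdpos : 0 < d := lt_of_le_of_ne hd0 (Ne.symm hdeg)
  have hden : 0 < V + d ^ 2 := by positivity
  -- A two-point law with variance `V` and one atom at distance `d` above the mean has its other
  -- atom at distance `V / d` below it.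
  have hl₂' : l₂ = 2 * (m - M) + d := by rw [hl₂, hd]; ring
  have hl₁' : l₁ = 2 * (m - M) - V / d := by rw [hl₁]; ring
  have hVd : 0 ≤ V / d := by positivity
  have hlt : l₁ < l₂ := by rw [hl₁', hl₂']; linarith
  have h₂ : M + l₂ ∈ Set.Icc lo hi := by rw [hl₂, add_sub_cancel]; exact ⟨hlohi, le_rfl⟩
  have h₁ : M + l₁ ∈ Set.Icc lo hi := by
    refine ⟨?_, by linarith [h₂.2]⟩
    have : V / d ≤ 2 * m - M - lo := (div_le_iff₀ hdpos).2 hVle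
    rw [hl₁']
    linarith
  have hp0 : 0 ≤ p := by rw [hp]; positivity
  have hp1 : p ≤ 1 := by rw [hp, div_le_one hden]; nlinarith
  have hmean : (1 - p) * l₁ + p * l₂ = 2 * (m - M) := by
    rw [hl₁', hl₂', hp]; field_simp; ring
  have hsq : (1 - p) * l₁ ^ 2 + p * l₂ ^ 2 = 3 * (σ ^ 2 + (m - M) ^ 2) := by
    have : (1 - p) * l₁ ^ 2 + p * l₂ ^ 2 = V + (2 * (m - M)) ^ 2 := by
      rw [hl₁', hl₂', hp]; field_simp; ring
    rw [this, hVdef]; ring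
  -- Constant extension beyond `[lo, hi]` gives a globally continuous function that equals `W`
  -- almost surely under every admissible law.
  set w : ℝ → ℝ := fun x => f (max lo (min hi x)) with hw
  have hwc : Continuous w := by
    have hfc : ContinuousOn f (Set.Icc lo hi) :=
      fun x hx => (hf x (hI hx)).continuousAt.continuousWithinAt
    exact hfc.comp_continuous (by fun_prop) fun x =>
      ⟨le_max_left _ _, max_le hlohi (min_le_left _ _)⟩
  have hwf : Set.EqOn w f (Set.Icc lo hi) := fun x hx => by
    simp only [hw, min_eq_right hx.2, max_eq_right hx.1]
  have hWw : Set.EqOn (MMs.W s μ) w (Set.Icc lo hi) := fun x hx =>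
    (hWf (hI hx)).trans (hwf hx).symm
  have hWint : ∀ P ∈ unimodalAmbiguitySet m σ M lo hi, (fun x => MMs.W s μ x) =ᵐ[P] w :=
    fun P hP => hP.2.1.mono fun x hx => hWw hx
  have hWs : ∀ z, M + z ∈ Set.Icc lo hi → Wstar s μ M z = segmentMean w M z := fun z hz => by
    rw [Wstar_eq_segmentMean, segmentMean_congr hM hz hWw]
  refine ⟨fun P hP => ?_, ⟨_, mixture_mem_unimodalAmbiguitySet hM h₁ h₂ hp0 hp1 hmean hsq, ?_⟩, ?_⟩
  · have := hP.1
    exact (integrable_of_ae_mem_Icc hP.2.1 hwc).congr (hWint P hP).symm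
  · have hmem := mixture_mem_unimodalAmbiguitySet hM h₁ h₂ hp0 hp1 hmean hsq
    dsimp only
    rw [integral_congr_ae (hWint _ hmem), integral_mixture hp0 hp1
      (integrable_of_ae_mem_Icc (ae_segmentLaw_mem_Icc hM h₁) hwc)
      (integrable_of_ae_mem_Icc (ae_segmentLaw_mem_Icc hM h₂) hwc),
      integral_segmentLaw hwc, integral_segmentLaw hwc, hWs _ h₁, hWs _ h₂]
  · rintro _ ⟨P, hP, rfl⟩
    dsimp only
    rw [integral_congr_ae (hWint P hP), hWs _ h₁, hWs _ h₂]
    set F := segmentMean w M l₁ with hF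
    set G := ∫ u in (0 : ℝ)..1, u * f' (M + l₁ * u) with hG
    -- `F` and `G` fix value and slope of the majorant at `l₁`; `κ` is the curvature that makes it
    -- meet the segment mean at `l₂`.
    obtain ⟨κ, hκ⟩ : ∃ κ, segmentMean w M l₂ = F + G * (l₂ - l₁) + κ * (l₂ - l₁) ^ 2 := by
      refine ⟨(segmentMean w M l₂ - F - G * (l₂ - l₁)) / (l₂ - l₁) ^ 2, ?_⟩
      have : l₂ - l₁ ≠ 0 := (sub_pos.2 hlt).ne'
      field_simp
      ring
    have hq : ∀ z, M + z ∈ Set.Icc lo hi → segmentMean w M z ≤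
        (F - G * l₁ + κ * l₁ ^ 2) + (G - 2 * κ * l₁) * z + κ * z ^ 2 := fun z hz => by
      have h := segmentMean_le_hermite Set.ordConnected_Ico hf hf' hc hm (hI hM) (hI h₁) (hI h₂)
        (hI hz) (z := z) (by linarith [hz.2])
      rw [← segmentMean_congr hM hz hwf, ← segmentMean_congr hM h₁ hwf,
        ← segmentMean_congr hM h₂ hwf, hκ] at h
      have h' : segmentMean w M z - F - G * (z - l₁) ≤ κ * (z - l₁) ^ 2 := by
        refine le_of_mul_le_mul_right ?_ (pow_pos (sub_pos.2 hlt) 2)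
        linarith
      linarith
    refine (integral_le_of_segmentMean_le hP hwc hq).trans_eq ?_
    -- The two-point law has the same moments, so the mean of the quadratic is the weighted sum of
    -- its values at `l₁` and `l₂`.
    rw [hκ, ← hmean, ← hsq]
    ring
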